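/- **Setting.** A *model* consists of: a finite set $I$; for each $i\in I$ maps $f^{(i)}_j(x)=r_i x+t^{(i)}_j$, $1\le j\le k_i$ ($k_i=1$ is allowed), with $0<|r_i|<1$ and $t^{(i)}_j\in\mathbb R$, and a probability vector $(p^{(i)}_1,\dots,p^{(i)}_{k_i})$ with strictly positive entries; and a probability measure $\mathbb P$ on $\Omega=I^{\mathbb N}$ invariant under the left shift $\sigma$. For $\omega\in\Omega$ and $u\in X^{(\omega)}_\infty=\prod_{n\ge1}\{1,\dots,k_{\omega_n}\}$ let $$\Pi_\omega(u)=\sum_{n=1}^\infty\Big(\prod_{j=1}^{n-1}r_{\omega_j}\Big)t^{(\omega_n)}_{u_n},\qquad Y^{(\omega)}=\Pi_\omega\big(X^{(\omega)}_\infty\big),$$ and let $\eta^{(\omega)}$ be the image under $\Pi_\omega$ of the product measure $\prod_{n\ge 1}(p^{(\omega_n)}_1,\dots,p^{(\omega_n)}_{k_{\omega_n}})$. The model is *non-trivial* if $\eta^{(\omega)}$ has no atoms for $\mathbb P$-a.e. $\omega$; it is *Bernoulli* if $\mathbb P=q^{\mathbb N}$ for some probability vector $q$ on $I$; it has *strong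 separation* if for every $\omega\in\Omega$ the sets $f^{(\omega_1)}_v(Y^{(\sigma\omega)})$, $1\le v\le k_{\omega_1}$, are pairwise disjoint. Let $\mathcal P(X)$ be the set of Borel probability measures on $X$ with the weak topology, and $\mathcal M^\square=\{\mu\in\mathcal P([-1,1]):0\in\operatorname{supp}\mu\}$. For $\mu\in\mathcal P(\mathbb R)$ and $x\in\operatorname{supp}\mu$, let $\mu_x\in\mathcal M^\square$ be $\mu_x(E)=c\,\mu(E+x)$; for $\mu\in\mathcal M^\square$ and $t\ge0$ let $S_t\mu(E)=c'\mu(e^{-t}E)$ ($E\subseteq[-1,1]$ Borel; $c,c'$ normalizing constants). A *distribution* is an element of $\mathcal P(\mathcal P([-1,1]))$. It is *non-trivial* if it is not the point mass at $\delta_0$, and *$S$-ergodic* if it gives full mass to $\mathcal M^\square$, is invariant under every $S_t$, $t\ge 0$, and every Borel set that is invariant modulo null sets under all $S_t$ is null or co-null. A measure $\mu\in\mathcal P(\mathbb R)$ *generates* $Q$ if for $\mu$-a.e. $x$ and every $f\in C(\mathcal P([-1,1]))$, $$\lim_{T\to\infty}\frac1T\int_0^T f(S_t\mu_x)\,dt=\int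 f\,dQ .$$ **Theorem.** For every non-trivial Bernoulli model with strong separation there is a single non-trivial $S$-ergodic distribution $Q$ such that for $\mathbb P$-a.e. $\omega$ the measure $\eta^{(\omega)}$ generates $Q$. Moreover, $Q$ is explicitly a factor of a suspension flow over a Bernoulli or Markov measure, as follows. There is $\tau\ge0$ such that for all $\omega\in\Omega$ and $v\ne v'$ the sets $f^{(\omega_1)}_v(Y^{(\sigma\omega)})$ and $f^{(\omega_1)}_{v'}(Y^{(\sigma\omega)})$ are at distance at least $e^{-\tau}$ (for instance $\tau=0$ if all these distances are greater than $2$), and for every such $\tau$: 1. If $r_i>0$ for all $i$ with $q_i>0$, let $m$ be the Bernoulli measure on sequences $(\omega_n,u_n)_{n\ge1}$ of symbols $(i,u)$, $i\in I$, $1\le u\le k_i$, with weights $q_i\,p^{(i)}_u$. Then $(\omega,u,s)\mapsto S_{\tau+s}\big(\eta^{(\omega)}_{\Pi_\omega(u)}\big)$ is a factor map onto $(Q,S)$ from the suspension semiflow over the shift with base measure $m$ and roof function $-\log r_{\omega_1}$ (with its suspension measure, the normalized restriction of $m\times\text{Lebesgue}$ to $0\le s<-\log r_{\omega_1}$). 2.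 If $r_i<0$ for some $i$ with $q_i>0$, let $m$ be the Markov measure on sequences $(\omega_n,u_n,a_n)_{n\ge1}$ of symbols $(i,u,a)$ with $a\in\mathbb Z/2$, with stationary probabilities $\tfrac12q_ip^{(i)}_u$ and with transition probability from $(i,u,a)$ to $(i',u',a')$ equal to $q_{i'}p^{(i')}_{u'}$ if $a'=a$ and $r_i>0$, or $a'\ne a$ and $r_i<0$, and $0$ otherwise; this chain is irreducible (on the states of positive stationary probability). Then $(\omega,u,a,s)\mapsto S_{\tau+s}\,\eta_{\omega,u,a_1}$ is a factor map onto $(Q,S)$ from the suspension semiflow over the shift with base measure $m$ and roof function $-\log|r_{\omega_1}|$, where $\eta_{\omega,u,0}=\eta^{(\omega)}_{\Pi_\omega(u)}$ and $\eta_{\omega,u,1}(E)=\eta_{\omega,u,0}(-E)$. Here a factor map is a measurable map that carries the suspension measure to $Q$ and intertwines, almost everywhere and for all times $t\ge0$, the suspension semiflow with $S_t$. -/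

import Mathlib

open MeasureTheory Set Filter Topology

noncomputable section

/-! ### Scenery of a measure on the line

`[-1,1]` is the subtype `Set.Icc (-1 : ℝ) 1`, measures on it are Mathlib's `ProbabilityMeasure`
with the topology of weak convergence, and distributions are probability measures on that space;
its measurable structure in Mathlib is generated by the evaluations `μ ↦ μ E`, which is the Borel
structure of the weak topology because `[-1,1]` is compact metric. -/

namespace Scenery

/-- The interval `[-1,1]`. -/
abbrev Window : Type := Set.Icc (-1 : ℝ) 1

instance : Nonempty Window := ⟨⟨0, by norm_num, by norm_num⟩⟩

/-- The origin of `[-1,1]`. -/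
def origin : Window := ⟨0, by norm_num, by norm_num⟩

/-- Distributions: probability measures on `𝒫([-1,1])`. -/
abbrev Distribution : Type := ProbabilityMeasure (ProbabilityMeasure Window)

/-- The probability measure `E ↦ c * ν (x + a * E)` on `[-1,1]`, where `c` is the normalizing
constant (used when `a ≠ 0` and `ν (x + a * [-1,1]) > 0`). -/
def blowUp (ν : Measure ℝ) [IsFiniteMeasure ν] (x a : ℝ) : ProbabilityMeasure Window :=
  FiniteMeasure.normalize
    ⟨Measure.comap (fun y : Window => x + a * (y : ℝ)) ν, inferInstance⟩

/-- A measure on `[-1,1]`, viewed as a measure on `ℝ`. -/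
abbrev toReal (μ : ProbabilityMeasure Window) : Measure ℝ :=
  (μ : Measure Window).map Subtype.val

/-- The measures on `[-1,1]` with `0` in their support. -/
def Centered : Set (ProbabilityMeasure Window) :=
  {μ | origin ∈ (μ : Measure Window).support}

/-- The translated and renormalized measure `μ_x (E) = c * μ (E + x)`. -/
def translate (μ : Measure ℝ) [IsFiniteMeasure μ] (x : ℝ) : ProbabilityMeasure Window :=
  blowUp μ x 1

/-- The scaling flow `S_t μ (E) = c' * μ (e^{-t} E)`, for `t ≥ 0`. -/
def scale (t : ℝ) (μ : ProbabilityMeasure Window) : ProbabilityMeasure Window :=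
  blowUp (toReal μ) 0 (Real.exp (-t))

/-- The reflected measure `E ↦ μ (-E)`. -/
def reflect (μ : ProbabilityMeasure Window) : ProbabilityMeasure Window :=
  blowUp (toReal μ) 0 (-1)

/-- The scenery `μ_{x,t} = S_t (μ_x)`. -/
def scenery (μ : Measure ℝ) [IsFiniteMeasure μ] (x t : ℝ) : ProbabilityMeasure Window :=
  scale t (translate μ x)

/-- `μ` generates `Q` at `x`: the scenery of `μ` at `x` equidistributes for `Q`. -/
def GeneratesAt (μ : Measure ℝ) [IsFiniteMeasure μ] (Q : Distribution) (x : ℝ) : Prop :=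
  x ∈ μ.support ∧ ∀ f : C(ProbabilityMeasure Window, ℝ),
    Tendsto (fun T : ℝ => T⁻¹ * ∫ t in (0 : ℝ)..T, f (scenery μ x t)) atTop
      (𝓝 (∫ ν, f ν ∂(Q : Measure (ProbabilityMeasure Window))))

/-- `μ` generates `Q`: it does so at `μ`-almost every point. -/
def Generates (μ : Measure ℝ) [IsFiniteMeasure μ] (Q : Distribution) : Prop :=
  ∀ᵐ x ∂μ, GeneratesAt μ Q x

/-- The trivial distribution, concentrated at `δ_0`. -/
def trivialDistribution : Distribution := diracProba (diracProba origin)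

/-- `S`-ergodic distributions: supported on `Centered`, invariant under `S_t` for all `t ≥ 0`, and
such that every measurable set that is invariant (mod `Q`) under all `S_t` is null or co-null. -/
structure IsErgodic (Q : Distribution) : Prop where
  centered : ∀ᵐ μ ∂(Q : Measure (ProbabilityMeasure Window)), μ ∈ Centered
  invariant : ∀ t : ℝ, 0 ≤ t → MeasurePreserving (scale t)
    (Q : Measure (ProbabilityMeasure Window)) (Q : Measure (ProbabilityMeasure Window))
  ergodic : ∀ A : Set (ProbabilityMeasure Window), MeasurableSet A →
    (∀ t : ℝ, 0 ≤ t → scale t ⁻¹' A =ᵐ[(Q : Measure (ProbabilityMeasure Window))] A) →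
    (Q : Measure (ProbabilityMeasure Window)) A = 0 ∨
      (Q : Measure (ProbabilityMeasure Window)) Aᶜ = 0

end Scenery

/-! ### Shifts, Markov measures, suspension semiflows and factors -/

namespace Suspension

/-- The left shift on sequences. -/
def shift {S : Type*} (x : ℕ → S) : ℕ → S := fun n => x (n + 1)

/-- `m` is the law of the stationary Markov chain with transition matrix `A` and stationary
probability vector `w`, and the chain is irreducible: every state can be reached from every state
(states of weight `0`, which are never visited, are disregarded as targets). -/
structure IsIrreducibleMarkov {S : Type*} [Fintype S] [MeasurableSpace S]
    (w : S → ℝ) (A : S → S → ℝ) (m : Measure (ℕ → S)) : Prop where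
  nonneg : ∀ s, 0 ≤ w s
  sum_eq_one : ∑ s, w s = 1
  transition_nonneg : ∀ s s', 0 ≤ A s s'
  transition_sum : ∀ s, ∑ s', A s s' = 1
  stationary : ∀ s', ∑ s, w s * A s s' = w s'
  irreducible : ∀ s s', 0 < w s' → Relation.TransGen (fun a b => 0 < A a b) s s'
  isProbabilityMeasure : IsProbabilityMeasure m
  cylinder : ∀ (n : ℕ) (a : ℕ → S), m.real {x | ∀ j ≤ n, x j = a j} =
    w (a 0) * ∏ j ∈ Finset.range n, A (a j) (a (j + 1))

/-- The number of complete passages up to time `t ≥ 0` through the roof `ρ > 0`, starting from the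
bottom over `x`: the largest `n` with `ρ x + ρ (T x) + ⋯ + ρ (T^(n-1) x) ≤ t`. -/
def passages {X : Type*} (T : X → X) (ρ : X → ℝ) (x : X) (t : ℝ) : ℕ :=
  sSup {n : ℕ | birkhoffSum T ρ n x ≤ t}

/-- The suspension semiflow over `T` with roof `ρ` on `{(x, s) | 0 ≤ s < ρ x}`: move up at unit
speed, and jump from `(x, ρ x)` to `(T x, 0)`. -/
def flow {X : Type*} (T : X → X) (ρ : X → ℝ) (t : ℝ) (z : X × ℝ) : X × ℝ :=
  (T^[passages T ρ z.1 (z.2 + t)] z.1,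
    z.2 + t - birkhoffSum T ρ (passages T ρ z.1 (z.2 + t)) z.1)

/-- The suspension measure: `m × Lebesgue` restricted to `{(x, s) | 0 ≤ s < ρ x}`, normalized. -/
def measure {X : Type*} [MeasurableSpace X] (m : Measure X) (ρ : X → ℝ) : Measure (X × ℝ) :=
  (ENNReal.ofReal (∫ x, ρ x ∂m))⁻¹ •
    (m.prod volume).restrict {z : X × ℝ | 0 ≤ z.2 ∧ z.2 < ρ z.1}

/-- `F` is a factor map from the suspension semiflow over `(X, m, T)` with roof `ρ` to the scaling
flow on `𝒫([-1,1])` with the distribution `Q`. -/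
structure IsFactorMap {X : Type*} [MeasurableSpace X] (m : Measure X) (T : X → X) (ρ : X → ℝ)
    (F : X × ℝ → ProbabilityMeasure Scenery.Window) (Q : Scenery.Distribution) : Prop where
  measurePreserving : MeasurePreserving F (measure m ρ)
    (Q : Measure (ProbabilityMeasure Scenery.Window))
  equivariant : ∀ᵐ z ∂(measure m ρ), ∀ t : ℝ, 0 ≤ t → F (flow T ρ t z) = Scenery.scale t (F z)

end Suspension

/-! ### Models -/

/-- A model: finitely many homogeneous iterated function systems
`Φ^(i) = (f^(i)_1, …, f^(i)_{k i})`, `f^(i)_j (x) = r i * x + t i j`, strictly positive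
probability vectors `p i`, and a shift-invariant selection measure `P` on `I^ℕ`. -/
structure Model (I : Type*) [Fintype I] [MeasurableSpace I] where
  k : I → ℕ
  r : I → ℝ
  r_ne_zero : ∀ i, r i ≠ 0
  abs_r_lt_one : ∀ i, |r i| < 1
  t : ∀ i, Fin (k i) → ℝ
  p : ∀ i, Fin (k i) → ℝ
  p_pos : ∀ i j, 0 < p i j
  p_sum : ∀ i, ∑ j, p i j = 1
  P : Measure (ℕ → I)
  isProbabilityMeasure : IsProbabilityMeasure P
  invariant : MeasurePreserving Suspension.shift P P

namespace Model

variable {I : Type*} [Fintype I] [MeasurableSpace I] (M : Model I)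

/-- The map `f^(i)_j`. -/
def f (i : I) (j : Fin (M.k i)) (x : ℝ) : ℝ := M.r i * x + M.t i j

/-- The space `X_∞^(ω)` of infinite words (letters are numbered from `0`). -/
abbrev Words (ω : ℕ → I) : Type := ∀ n, Fin (M.k (ω n))

/-- The coding map `Π_ω`. -/
def coding (ω : ℕ → I) (u : M.Words ω) : ℝ :=
  ∑' n, (∏ j ∈ Finset.range n, M.r (ω j)) * M.t (ω n) (u n)

/-- The set `Y^(ω)`. -/
def Y (ω : ℕ → I) : Set ℝ := range (M.coding ω)

/-- The strong separation condition. -/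
def StrongSeparation : Prop :=
  ∀ ω : ℕ → I, Pairwise fun u v : Fin (M.k (ω 0)) =>
    Disjoint (M.f (ω 0) u '' M.Y (Suspension.shift ω)) (M.f (ω 0) v '' M.Y (Suspension.shift ω))

/-- The probability vector `p i`, as a measure. -/
def letterMeasure (i : I) : Measure (Fin (M.k i)) :=
  ∑ j, ENNReal.ofReal (M.p i j) • Measure.dirac j

instance (i : I) : IsProbabilityMeasure (M.letterMeasure i) := ⟨by
  rw [letterMeasure, Measure.coe_finsetSum, Finset.sum_apply]
  simp only [Measure.smul_apply, measure_univ, smul_eq_mul, mul_one]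
  rw [← ENNReal.ofReal_sum_of_nonneg fun j _ => (M.p_pos i j).le, M.p_sum, ENNReal.ofReal_one]⟩

/-- The product measure `η̄^(ω)` on `X_∞^(ω)`. -/
def wordMeasure (ω : ℕ → I) : Measure (M.Words ω) :=
  Measure.infinitePi fun n => M.letterMeasure (ω n)

instance (ω : ℕ → I) : IsProbabilityMeasure (M.wordMeasure ω) := by
  unfold wordMeasure; infer_instance

/-- The random measure `η^(ω)`, the image of `η̄^(ω)` under the coding map. -/
def eta (ω : ℕ → I) : Measure ℝ := (M.wordMeasure ω).map (M.coding ω)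

theorem summable_coding (ω : ℕ → I) (u : M.Words ω) :
    Summable fun n => (∏ j ∈ Finset.range n, M.r (ω j)) * M.t (ω n) (u n) := by
  have hne : (Finset.univ : Finset I).Nonempty := ⟨ω 0, Finset.mem_univ _⟩
  obtain ⟨i₀, -, hi₀⟩ := Finset.exists_max_image Finset.univ (fun i => |M.r i|) hne
  have hc : |M.r i₀| < 1 := M.abs_r_lt_one i₀
  refine Summable.of_norm_bounded
    (g := fun n => |M.r i₀| ^ n * ∑ i, ∑ j, |M.t i j|)
    ((summable_geometric_of_lt_one (abs_nonneg _) hc).mul_right _) fun n => ?_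
  rw [norm_mul, Real.norm_eq_abs, Real.norm_eq_abs, Finset.abs_prod]
  refine mul_le_mul ?_ ?_ (abs_nonneg _) (by positivity)
  · calc ∏ j ∈ Finset.range n, |M.r (ω j)| ≤ ∏ _j ∈ Finset.range n, |M.r i₀| :=
          Finset.prod_le_prod (fun _ _ => abs_nonneg _) fun j _ => hi₀ _ (Finset.mem_univ _)
      _ = |M.r i₀| ^ n := by simp
  · calc |M.t (ω n) (u n)| ≤ ∑ j, |M.t (ω n) j| :=
          Finset.single_le_sum (f := fun j => |M.t (ω n) j|)
            (fun _ _ => abs_nonneg _) (Finset.mem_univ _)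
      _ ≤ ∑ i, ∑ j, |M.t i j| :=
          Finset.single_le_sum (f := fun i => ∑ j, |M.t i j|)
            (fun _ _ => Finset.sum_nonneg fun _ _ => abs_nonneg _) (Finset.mem_univ _)

theorem measurable_coding (ω : ℕ → I) : Measurable (M.coding ω) := by
  refine measurable_of_tendsto_metrizable
    (f := fun n u => ∑ l ∈ Finset.range n,
      (∏ j ∈ Finset.range l, M.r (ω j)) * M.t (ω l) (u l)) (fun n => ?_) ?_
  · refine Finset.measurable_sum _ fun l _ => ?_
    exact measurable_const.mul ((measurable_of_finite _).comp (measurable_pi_apply l))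
  · rw [tendsto_pi_nhds]
    exact fun u => (M.summable_coding ω u).hasSum.tendsto_sum_nat

instance (ω : ℕ → I) : IsProbabilityMeasure (M.eta ω) :=
  Measure.isProbabilityMeasure_map (M.measurable_coding ω).aemeasurable

/-- The model is non-trivial: almost surely `η^(ω)` has no atoms. -/
def IsNontrivial : Prop := ∀ᵐ ω ∂M.P, ∀ x, M.eta ω {x} = 0

/-- The model is Bernoulli: `P` is an infinite power of a probability measure on `I`. -/
def IsBernoulli : Prop :=
  ∃ q : Measure I, IsProbabilityMeasure q ∧ M.P = Measure.infinitePi fun _ : ℕ => q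

/-! #### The explicit description of the generated distribution -/

/-- All pieces `f_u^(ω_1) (Y^(σω))` are at distance at least `e^{-τ}` from each other. If the
pieces are at distance `> 2` from each other, this holds with `τ = 0`. -/
def SeparatedAtScale (τ : ℝ) : Prop :=
  ∀ (ω : ℕ → I) (u v : Fin (M.k (ω 0))), u ≠ v →
    ∀ y ∈ M.f (ω 0) u '' M.Y (Suspension.shift ω), ∀ z ∈ M.f (ω 0) v '' M.Y (Suspension.shift ω),
      Real.exp (-τ) ≤ |y - z|

/-- The alphabet `{(i, u) | i ∈ I, 1 ≤ u ≤ k i}`. -/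
abbrev Symbols : Type _ := Σ i : I, Fin (M.k i)

/-- The weight `P([i])` of the cylinder of `i`. -/
def q (i : I) : ℝ := M.P.real {ω | ω 0 = i}

/-- The weight `P([i]) * p_u^(i)` of the symbol `(i, u)`. -/
def symbolWeight (s : M.Symbols) : ℝ := M.q s.1 * M.p s.1 s.2

/-- The Bernoulli measure on sequences of symbols `(i, u)` with weights `P([i]) * p_u^(i)`. -/
def bernoulliBase : Measure (ℕ → M.Symbols) :=
  Measure.infinitePi fun _ : ℕ =>
    ∑ s : M.Symbols, ENNReal.ofReal (M.symbolWeight s) • Measure.dirac s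

/-- The measure `η_{ω,u}`: the measure `η^(ω)` translated by `Π_ω (u)` and renormalized. -/
def etaAt (x : ℕ → M.Symbols) : ProbabilityMeasure Scenery.Window :=
  Scenery.translate (M.eta fun n => (x n).1)
    (M.coding (fun n => (x n).1) fun n => (x n).2)

/-- The roof function `-log |r_{ω_1}|`. -/
def roof (x : ℕ → M.Symbols) : ℝ := -Real.log |M.r (x 0).1|

/-- The map `(ω, u, s) ↦ S_{τ + s} η_{ω,u}`. -/
def sceneryMap (τ : ℝ) (z : (ℕ → M.Symbols) × ℝ) : ProbabilityMeasure Scenery.Window :=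
  Scenery.scale (τ + z.2) (M.etaAt z.1)

/-- The states `(i, u, a)` that also record an orientation `a ∈ ℤ/2`. -/
abbrev SignedSymbols : Type _ := M.Symbols × ZMod 2

/-- Stationary weights `P([i]) * p_u^(i) / 2`. -/
def signedWeight (s : M.SignedSymbols) : ℝ := M.symbolWeight s.1 / 2

open Classical in
/-- Transition probabilities from `(i, u, a)` to `(i', u', a')`: equal to `P([i']) * p_{u'}^(i')` if
`a' = a` and `r i > 0`, or if `a' ≠ a` and `r i < 0`; and `0` otherwise. -/
def signedTransition (s s' : M.SignedSymbols) : ℝ :=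
  if (s'.2 = s.2 ∧ 0 < M.r s.1.1) ∨ (s'.2 ≠ s.2 ∧ M.r s.1.1 < 0) then M.symbolWeight s'.1 else 0

open Classical in
/-- The measure `η_{ω,u,a}`: equal to `η_{ω,u}` if `a = 0`, and to its reflection if `a = 1`. Only
the first orientation symbol of a sequence matters. -/
def signedEtaAt (x : ℕ → M.SignedSymbols) : ProbabilityMeasure Scenery.Window :=
  if (x 0).2 = 0 then M.etaAt (fun n => (x n).1) else Scenery.reflect (M.etaAt fun n => (x n).1)

/-- The roof function `-log |r_{ω_1}|`. -/
def signedRoof (x : ℕ → M.SignedSymbols) : ℝ := M.roof fun n => (x n).1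

/-- The map `(ω, u, a, s) ↦ S_{τ + s} η_{ω,u,a}`. -/
def signedSceneryMap (τ : ℝ) (z : (ℕ → M.SignedSymbols) × ℝ) :
    ProbabilityMeasure Scenery.Window :=
  Scenery.scale (τ + z.2) (M.signedEtaAt z.1)

end Model

end

/-! Choosing `ω` by `P` and then a word by the product measure makes the symbols `(ω_n, u_n)`
independent and identically distributed. Look at `η^(ω)` around `Π_ω(u)` through a window of radius
`|r_{ω_1}| e^{-t}` with `t ≥ τ`. By separation it meets only the first-level piece containing the
point. That piece is an affine copy of `η^(σω)`, carrying mass `p_{u_1}`, which normalization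
cancels. So from time `τ` on, letting the time `-log |r_{ω_1}|` pass amounts to shifting the symbols
(`pullback_eta`, `blowUpAt_shift`): the scenery is read off from the suspension semiflow. If
`r_{ω_1} < 0` the copy is also reflected, so an orientation in `ℤ/2` has to be carried along, and
the base becomes a `ℤ/2`-extension of the Bernoulli shift. `IsOriented` treats both bases at once,
and `IsOriented.isCover` is the resulting semiconjugacy.

`Q` is the law of `S_{τ+s} η_{ω,u}` (or its oriented version) under the suspension measure. The rest
is ergodic theory of the base. The shift and its extension are ergodic because a function that the
shift reproduces up to a factor depending on the first letter vanishes as soon as its mean does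
(`ae_eq_zero_of_twisted`). Invariance and ergodicity pass to the suspension and to its factor `Q`
(`IsOrbital.integral_translate`, `IsOrbital.ae_const`). Equidistribution is the pointwise ergodic
theorem (`ae_tendsto_birkhoffSum_div`) for the roof and for the integrals up to the roof, followed
by interpolation between return times. A countable dense set of test functions suffices, since
`𝒫([-1,1])` is compact and metrizable.

The remaining points are softer. A scale `τ` exists by compactness (`exists_separatedAtScale`). `Q`
does not depend on `τ`, because it is invariant under the flow (`IsOriented.law_eq`). It is
non-trivial because blow-ups of an atomless measure do not charge the origin. -/

noncomputable section

/-! ### Infinite products indexed by `ℕ` -/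

/-- Prepend a letter to a (dependent) sequence. -/
def natCons {X : ℕ → Type*} (a : X 0) (x : ∀ n, X (n + 1)) : ∀ n, X n
  | 0 => a
  | n + 1 => x n

theorem measurable_natCons {X : ℕ → Type*} [∀ n, MeasurableSpace (X n)] :
    Measurable fun z : X 0 × (∀ n, X (n + 1)) => natCons z.1 z.2 := by
  refine measurable_pi_lambda _ fun n => ?_
  cases n with
  | zero => exact measurable_fst
  | succ n => exact (measurable_pi_apply n).comp measurable_snd

theorem map_natCons_prod_infinitePi {X : ℕ → Type*} [∀ n, MeasurableSpace (X n)]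
    (μ : ∀ n, Measure (X n)) [∀ n, IsProbabilityMeasure (μ n)] :
    ((μ 0).prod (Measure.infinitePi fun n => μ (n + 1))).map (fun z => natCons z.1 z.2) =
      Measure.infinitePi μ := by
  classical
  refine Measure.eq_infinitePi _ fun s t ht => ?_
  obtain ⟨N, hN⟩ : ∃ N, s ⊆ Finset.range (N + 1) :=
    ⟨s.sup id, fun i hi => Finset.mem_range.2 (Nat.lt_succ_of_le (Finset.le_sup (f := id) hi))⟩
  -- Unconstrained coordinates are filled in with `univ`, so that the box runs over an initial
  -- segment and its zeroth factor splits off.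
  set t' : ∀ i, Set (X i) := fun i => if i ∈ s then t i else univ with ht'
  have hm : ∀ i, MeasurableSet (t' i) := fun i => by
    by_cases h : i ∈ s
    · simpa only [ht', h, if_true] using ht i
    · simp only [ht', h, if_false, MeasurableSet.univ]
  have hpre : (fun z : X 0 × (∀ n, X (n + 1)) => natCons z.1 z.2) ⁻¹' (Set.pi s t) =
      t' 0 ×ˢ Set.pi (Finset.range N) (fun i => t' (i + 1)) := by
    ext ⟨a, x⟩
    simp only [mem_preimage, Set.mem_pi, mem_prod, Finset.mem_coe, Finset.mem_range, ht']
    constructor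
    · intro h
      refine ⟨?_, fun i _ => ?_⟩
      · split_ifs with h0
        · exact h 0 h0
        · trivial
      · split_ifs with h0
        · exact h (i + 1) h0
        · trivial
    · rintro ⟨h0, h1⟩ i hi
      cases i with
      | zero => rw [if_pos hi] at h0; exact h0
      | succ i =>
        have := h1 i (by have := Finset.mem_range.1 (hN hi); omega)
        rw [if_pos hi] at this; exact this
  rw [Measure.map_apply measurable_natCons
    (MeasurableSet.pi s.countable_toSet fun i _ => ht i), hpre, Measure.prod_prod,
    Measure.infinitePi_pi _ fun i _ => hm (i + 1), mul_comm,
    ← Finset.prod_range_succ' (fun i => μ i (t' i)) N, ← Finset.prod_subset hN]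
  · exact Finset.prod_congr rfl fun i hi => by simp only [ht', hi, if_true]
  · exact fun i _ hi => by simp only [ht', hi, if_false, measure_univ]

theorem measurePreserving_natCons {X : ℕ → Type*} [∀ n, MeasurableSpace (X n)]
    (μ : ∀ n, Measure (X n)) [∀ n, IsProbabilityMeasure (μ n)] :
    MeasurePreserving (fun z : X 0 × (∀ n, X (n + 1)) => natCons z.1 z.2)
      ((μ 0).prod (Measure.infinitePi fun n => μ (n + 1))) (Measure.infinitePi μ) :=
  ⟨measurable_natCons, map_natCons_prod_infinitePi μ⟩

/-! ### Ergodicity of Bernoulli shifts -/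

section Shift

variable {S : Type*} [MeasurableSpace S] (ν : Measure S) [IsProbabilityMeasure ν]

theorem Suspension.measurable_shift {S : Type*} [MeasurableSpace S] :
    Measurable (Suspension.shift : (ℕ → S) → (ℕ → S)) :=
  measurable_pi_lambda _ fun n => measurable_pi_apply (n + 1)

theorem measurePreserving_shift_infinitePi :
    MeasurePreserving Suspension.shift (Measure.infinitePi fun _ : ℕ => ν)
      (Measure.infinitePi fun _ : ℕ => ν) := by
  refine ⟨Suspension.measurable_shift, ?_⟩
  conv_lhs => rw [← map_natCons_prod_infinitePi (fun _ : ℕ => ν)]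
  rw [Measure.map_map Suspension.measurable_shift measurable_natCons]
  exact (measurePreserving_snd (μ := ν) (ν := Measure.infinitePi fun _ : ℕ => ν)).map_eq

/-- The first letter is independent of the remaining ones. -/
theorem integral_infinitePi_mul_shift (φ : S → ℝ) (h : (ℕ → S) → ℝ) :
    ∫ x, φ (x 0) * h (Suspension.shift x) ∂(Measure.infinitePi fun _ : ℕ => ν) =
      (∫ s, φ s ∂ν) * ∫ x, h x ∂(Measure.infinitePi fun _ : ℕ => ν) := by
  have hemb : MeasurableEmbedding
      (fun z : S × (ℕ → S) => natCons (X := fun _ => S) z.1 z.2) := by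
    refine MeasurableEquiv.measurableEmbedding (⟨⟨fun z => natCons z.1 z.2,
      fun x => (x 0, Suspension.shift x), fun z => rfl, fun x => ?_⟩,
      measurable_natCons, ?_⟩ : S × (ℕ → S) ≃ᵐ (ℕ → S))
    · funext n; cases n <;> rfl
    · exact (measurable_pi_apply 0).prodMk Suspension.measurable_shift
  rw [← (measurePreserving_natCons fun _ : ℕ => ν).integral_comp hemb]
  exact integral_prod_mul (μ := ν) (ν := Measure.infinitePi fun _ : ℕ => ν) φ h

/-- An integrable function with mean zero that is carried by the shift to a multiple of itself by
a function of the first letter integrates to zero over all boxes. -/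
theorem setIntegral_box_eq_zero_of_twisted {χ : S → ℝ} {h : (ℕ → S) → ℝ}
    (hinv : h =ᵐ[Measure.infinitePi fun _ : ℕ => ν] fun x => χ (x 0) * h (Suspension.shift x))
    (h0 : ∫ x, h x ∂(Measure.infinitePi fun _ : ℕ => ν) = 0) (n : ℕ) :
    ∀ t : ℕ → Set S, (∀ i, MeasurableSet (t i)) →
      ∫ x in {x | ∀ j < n, x j ∈ t j}, h x ∂(Measure.infinitePi fun _ : ℕ => ν) = 0 := by
  have hbox : ∀ (n : ℕ) (t : ℕ → Set S), (∀ i, MeasurableSet (t i)) →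
      MeasurableSet {x : ℕ → S | ∀ j < n, x j ∈ t j} := fun n t ht => by
    have : {x : ℕ → S | ∀ j < n, x j ∈ t j} = ⋂ j ∈ Finset.range n, (fun x => x j) ⁻¹' t j := by
      ext x; simp
    rw [this]
    exact Finset.measurableSet_biInter _ fun j _ => measurable_pi_apply j (ht j)
  induction n with
  | zero => intro t _; simpa using h0
  | succ n ih =>
    intro t ht
    have hsucc : MeasurableSet {x : ℕ → S | ∀ j < n + 1, x j ∈ t j} := hbox (n + 1) t ht
    rw [← integral_indicator hsucc]
    set A : Set (ℕ → S) := {x | ∀ j < n, x j ∈ t (j + 1)} with hA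
    have hmA : MeasurableSet A := hbox n _ fun i => ht (i + 1)
    have hi0 := ih (fun j => t (j + 1)) (fun i => ht (i + 1))
    rw [← integral_indicator hmA] at hi0
    have e1 : indicator {x : ℕ → S | ∀ j < n + 1, x j ∈ t j} h
        =ᵐ[Measure.infinitePi fun _ : ℕ => ν]
        fun x => (indicator (t 0) χ (x 0)) * (indicator A h (Suspension.shift x)) := by
      filter_upwards [hinv] with x hx
      have hiff : (∀ j < n + 1, x j ∈ t j) ↔ (x 0 ∈ t 0 ∧ Suspension.shift x ∈ A) := by
        constructor
        · exact fun h => ⟨h 0 (by omega), fun j hj => h (j + 1) (by omega)⟩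
        · rintro ⟨h0, h1⟩ j hj
          cases j with
          | zero => exact h0
          | succ j => exact h1 j (by omega)
      by_cases hx0 : x 0 ∈ t 0
      · by_cases hx1 : Suspension.shift x ∈ A
        · rw [indicator_of_mem (show x ∈ {x : ℕ → S | ∀ j < n + 1, x j ∈ t j} from
            hiff.2 ⟨hx0, hx1⟩), indicator_of_mem hx0, indicator_of_mem hx1, hx]
        · rw [indicator_of_notMem (show x ∉ {x : ℕ → S | ∀ j < n + 1, x j ∈ t j} from
            fun h' => hx1 (hiff.1 h').2), indicator_of_notMem hx1, mul_zero]
      · rw [indicator_of_notMem (show x ∉ {x : ℕ → S | ∀ j < n + 1, x j ∈ t j} from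
            fun h' => hx0 (hiff.1 h').1), indicator_of_notMem hx0, zero_mul]
    rw [integral_congr_ae e1]
    rw [integral_infinitePi_mul_shift, hi0, mul_zero]

/-- Boxes form a generating π-system on which the integral of `h` vanishes, and the vanishing passes
to complements (because the mean is zero) and to disjoint unions. The factor `χ = 1` serves the
shift itself; `χ = ±1` serves its `ℤ/2`-extension. -/
theorem ae_eq_zero_of_twisted {χ : S → ℝ} {h : (ℕ → S) → ℝ}
    (hint : Integrable h (Measure.infinitePi fun _ : ℕ => ν))
    (hinv : h =ᵐ[Measure.infinitePi fun _ : ℕ => ν] fun x => χ (x 0) * h (Suspension.shift x))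
    (h0 : ∫ x, h x ∂(Measure.infinitePi fun _ : ℕ => ν) = 0) :
    h =ᵐ[Measure.infinitePi fun _ : ℕ => ν] 0 := by
  classical
  refine hint.ae_eq_zero_of_forall_setIntegral_eq_zero fun A hA _ => ?_
  induction A, hA using MeasurableSpace.induction_on_inter generateFrom_squareCylinders.symm
    (isPiSystem_squareCylinders (fun _ => MeasurableSpace.isPiSystem_measurableSet) (by simp)) with
  | empty => simp
  | basic A hA =>
    obtain ⟨s, t, ht, rfl⟩ := hA
    have ht : ∀ i, MeasurableSet (t i) := fun i => ht i (mem_univ i)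
    obtain ⟨N, hN⟩ : ∃ N, s ⊆ Finset.range (N + 1) :=
      ⟨s.sup id, fun i hi => Finset.mem_range.2 (Nat.lt_succ_of_le (Finset.le_sup (f := id) hi))⟩
    have : (s : Set ℕ).pi t = {x | ∀ j < N + 1, x j ∈ (if j ∈ s then t j else univ)} := by
      ext x
      simp only [Set.mem_pi, Finset.mem_coe, mem_ofPred_eq]
      constructor
      · intro h j _
        split_ifs with hj
        · exact h j hj
        · trivial
      · intro h j hj
        have := h j (Finset.mem_range.1 (hN hj))
        rwa [if_pos hj] at this
    rw [this]
    refine setIntegral_box_eq_zero_of_twisted ν hinv h0 (N + 1)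
      (fun j => if j ∈ s then t j else univ) fun i => ?_
    split_ifs
    · exact ht i
    · exact MeasurableSet.univ
  | compl A hA ih => rw [setIntegral_compl hA hint, ih (measure_lt_top _ _), h0, sub_zero]
  | iUnion f hd hm ih =>
    rw [integral_iUnion hm hd hint.integrableOn]
    simp only [ih _ (measure_lt_top _ _), tsum_zero]

/-- The centred indicator of an invariant set is a twisted function with `χ = 1` and mean zero,
hence vanishes. -/
theorem ergodic_shift_infinitePi :
    Ergodic Suspension.shift (Measure.infinitePi fun _ : ℕ => ν) := by
  refine ⟨measurePreserving_shift_infinitePi ν, ⟨fun A hA hinv => ?_⟩⟩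
  set μ := Measure.infinitePi fun _ : ℕ => ν
  set c := μ.real A
  have hint : Integrable (fun x => A.indicator (fun _ => (1 : ℝ)) x - c) μ :=
    ((integrable_const 1).indicator hA).sub (integrable_const c)
  have hz := ae_eq_zero_of_twisted ν (χ := fun _ => 1) hint
    (Eventually.of_forall fun x => by
      have : x ∈ A ↔ Suspension.shift x ∈ A := by rw [← mem_preimage, hinv]
      by_cases hx : x ∈ A
      · simp [hx, this.1 hx]
      · have h' : Suspension.shift x ∉ A := fun h => hx (this.2 h)
        simp only [indicator_of_notMem hx, indicator_of_notMem h', one_mul])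
    (by
      rw [integral_sub ((integrable_const 1).indicator hA) (integrable_const c),
        integral_indicator hA]
      simp [c, μ])
  rw [eventuallyConst_set']
  by_cases hc : c = 0
  · left
    filter_upwards [hz] with x hx
    by_contra hne
    have : x ∈ A := by
      by_contra h
      exact hne (propext ⟨fun h' => (h h').elim, fun h' => h'.elim⟩)
    simp [hc, this] at hx
  · right
    filter_upwards [hz] with x hx
    have : x ∈ A := by
      by_contra h
      simp [h, hc] at hx
    exact propext ⟨fun _ => trivial, fun _ => this⟩

end Shift

/-! ### The `ℤ/2`-extension of a Bernoulli shift -/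

section SkewProduct

variable {S : Type*} [MeasurableSpace S]

/-- The uniform probability measure on `ℤ/2`. -/
def coin : Measure (ZMod 2) := (2⁻¹ : ENNReal) • (Measure.dirac 0 + Measure.dirac 1)

instance : IsProbabilityMeasure coin := ⟨by
  simp only [coin, Measure.smul_apply, Measure.add_apply, measure_univ, smul_eq_mul]
  rw [one_add_one_eq_two, ENNReal.inv_mul_cancel (by norm_num) (by norm_num)]⟩

theorem coin_singleton (a : ZMod 2) : coin {a} = 2⁻¹ := by
  have h01 : a = 0 ∨ a = 1 := by revert a; decide
  have h : (0 : ZMod 2) ≠ 1 := by decide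
  rcases h01 with rfl | rfl <;> simp [coin, h, h.symm]

theorem map_add_coin (c : ZMod 2) : coin.map (fun a => a + c) = coin := by
  refine Measure.ext_of_singleton fun a => ?_
  rw [Measure.map_apply (measurable_of_finite _) (measurableSet_singleton a),
    show (fun a => a + c) ⁻¹' {a} = {a - c} by
      ext b; simp only [mem_preimage, mem_singleton_iff, eq_sub_iff_add_eq],
    coin_singleton, coin_singleton]

/-- The shift, together with the `ℤ/2`-cocycle given by a function of the first letter. -/
def skewShift (c : S → ZMod 2) (z : (ℕ → S) × ZMod 2) : (ℕ → S) × ZMod 2 :=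
  (Suspension.shift z.1, z.2 + c (z.1 0))

variable (ν : Measure S) [IsProbabilityMeasure ν]

theorem measurePreserving_skewShift {c : S → ZMod 2} (hc : Measurable c) :
    MeasurePreserving (skewShift c) ((Measure.infinitePi fun _ : ℕ => ν).prod coin)
      ((Measure.infinitePi fun _ : ℕ => ν).prod coin) := by
  refine MeasurePreserving.skew_product (g := fun x a => a + c (x 0))
    (measurePreserving_shift_infinitePi ν) ?_ (Eventually.of_forall fun x => map_add_coin _)
  exact (measurable_of_finite fun p : ZMod 2 × ZMod 2 => p.1 + p.2).comp (measurable_snd.prodMk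
    (hc.comp ((measurable_pi_apply 0).comp measurable_fst)))

theorem ae_prod_coin_iff {X : Type*} [MeasurableSpace X] {μ : Measure X} [SFinite μ]
    {p : X × ZMod 2 → Prop} :
    (∀ᵐ z ∂(μ.prod coin), p z) ↔ ∀ᵐ x ∂μ, ∀ a, p (x, a) := by
  constructor
  · intro h
    filter_upwards [Measure.ae_ae_of_ae_prod h] with x hx a
    by_contra hp
    have h1 : coin {a} = 0 := measure_mono_null (by rintro b rfl; exact hp) (ae_iff.1 hx)
    rw [coin_singleton] at h1
    simp at h1
  · intro h
    have := (measurePreserving_fst (μ := μ) (ν := coin)).quasiMeasurePreserving.ae h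
    filter_upwards [this] with z hz using hz z.2

/-- Fourier analysis in the fibre: for the indicator `g` of an invariant set, the even part `g 0 + g
1` is shift-invariant, hence constant, and the odd part `g 0 - g 1` is twisted by the sign `χ`. The
odd part vanishes because the cocycle is not almost surely zero. -/
theorem ergodic_skewShift {c : S → ZMod 2} (hc : Measurable c) (hν : ν (c ⁻¹' {0}) ≠ 1) :
    Ergodic (skewShift c) ((Measure.infinitePi fun _ : ℕ => ν).prod coin) := by
  classical
  refine ⟨measurePreserving_skewShift ν hc, ⟨fun A hA hinv => ?_⟩⟩
  set μ := Measure.infinitePi fun _ : ℕ => ν with hμ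
  set g : (ℕ → S) → ZMod 2 → ℝ := fun x a => A.indicator (fun _ => (1 : ℝ)) (x, a) with hg
  have hgm : ∀ a, Measurable fun x => g x a := fun a =>
    (measurable_const.indicator hA).comp (measurable_id.prodMk measurable_const)
  have hgi : ∀ a, Integrable (fun x => g x a) μ := fun a => by
    refine Integrable.of_bound (hgm a).aestronglyMeasurable 1 (Eventually.of_forall fun x => ?_)
    by_cases h : (x, a) ∈ A <;> simp [hg, h]
  have hginv : ∀ x a, g (Suspension.shift x) (a + c (x 0)) = g x a := fun x a => by
    have : (Suspension.shift x, a + c (x 0)) ∈ A ↔ (x, a) ∈ A := by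
      conv_rhs => rw [← hinv]
      rfl
    simp only [hg, indicator_apply, this]
  have h01 : ∀ b : ZMod 2, b = 0 ∨ b = 1 := by decide
  have h11 : (1 : ZMod 2) + 1 = 0 := by decide
  obtain ⟨k, hk⟩ := (ergodic_shift_infinitePi ν).ae_eq_const_of_ae_eq_comp_ae
    (g := fun x => g x 0 + g x 1) ((hgi 0).add (hgi 1)).aestronglyMeasurable
    (Eventually.of_forall fun x => by
      have h0 := hginv x 0
      have h1 := hginv x 1
      rcases h01 (c (x 0)) with h | h
      · rw [h, add_zero] at h0 h1
        simp only [Function.comp, h0, h1]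
      · rw [h, zero_add] at h0
        rw [h, h11] at h1
        simp only [Function.comp, h0, h1]
        ring)
  set χ : S → ℝ := fun s => if c s = 0 then 1 else -1 with hχ
  have htw : ∀ x, g x 0 - g x 1 = χ (x 0) * (g (Suspension.shift x) 0 - g (Suspension.shift x) 1) :=
    fun x => by
      have h0 := hginv x 0
      have h1 := hginv x 1
      rcases h01 (c (x 0)) with h | h
      · rw [h, add_zero] at h0 h1
        simp only [hχ, h, if_true, h0, h1, one_mul]
      · rw [h, zero_add] at h0
        rw [h, h11] at h1
        simp only [hχ, h, h0, h1]
        simp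
  -- The integral is `2 ν(c = 0) - 1`.
  have hχi : ∫ s, χ s ∂ν ≠ 1 := by
    have e : χ = fun s => 2 * (c ⁻¹' {0}).indicator (fun _ => (1 : ℝ)) s - 1 := by
      funext s
      by_cases h : c s = 0 <;> norm_num [hχ, h]
    have hm0 : MeasurableSet (c ⁻¹' {0}) := hc (measurableSet_singleton 0)
    rw [e, integral_sub (((integrable_const 1).indicator hm0).const_mul 2) (integrable_const 1),
      integral_const_mul, integral_indicator hm0]
    simp only [integral_const, measureReal_restrict_apply_univ, smul_eq_mul, mul_one,
      probReal_univ]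
    intro h
    apply hν
    have : ν.real (c ⁻¹' {0}) = 1 := by linarith
    rw [Measure.real, ENNReal.toReal_eq_one_iff] at this
    exact this
  -- By independence of the first letter, this mean equals itself times `∫ χ`, which is not `1`.
  have hzero : ∫ x, (g x 0 - g x 1) ∂μ = 0 := by
    have e1 : ∫ x, (g x 0 - g x 1) ∂μ =
        (∫ s, χ s ∂ν) * ∫ x, (g x 0 - g x 1) ∂μ := by
      conv_lhs => rw [integral_congr_ae (Eventually.of_forall htw)]
      exact integral_infinitePi_mul_shift ν χ fun x => g x 0 - g x 1
    have : (1 - ∫ s, χ s ∂ν) * ∫ x, (g x 0 - g x 1) ∂μ = 0 := by linarith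
    rcases mul_eq_zero.1 this with h | h
    · exact absurd (by linarith) hχi
    · exact h
  have hd := ae_eq_zero_of_twisted ν ((hgi 0).sub (hgi 1)) (Eventually.of_forall htw) hzero
  have hval : ∀ x a, g x a = 0 ∧ (x, a) ∉ A ∨ g x a = 1 ∧ (x, a) ∈ A := fun x a => by
    by_cases h : (x, a) ∈ A <;> simp [hg, h]
  have hae : ∀ᵐ x ∂μ, ∀ a, g x a = k / 2 := by
    filter_upwards [hk, hd] with x h1 h2 a
    have h1 : g x 0 + g x 1 = k := h1
    have h2 : g x 0 - g x 1 = 0 := h2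
    rcases h01 a with rfl | rfl <;> linarith
  rw [eventuallyConst_set']
  by_cases hk0 : k = 0
  · left
    filter_upwards [(ae_prod_coin_iff (p := fun z => g z.1 z.2 = k / 2)).2 hae] with z hz
    rcases hval z.1 z.2 with h | h
    · exact propext ⟨fun h' => (h.2 h').elim, fun h' => h'.elim⟩
    · rw [h.1, hk0] at hz; norm_num at hz
  · right
    filter_upwards [(ae_prod_coin_iff (p := fun z => g z.1 z.2 = k / 2)).2 hae] with z hz
    rcases hval z.1 z.2 with h | h
    · rw [h.1] at hz
      exact absurd (by linarith) hk0
    · exact propext ⟨fun _ => trivial, fun _ => h.2⟩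

end SkewProduct

/-! ### The pointwise ergodic theorem for bounded functions -/

section Birkhoff

variable {X : Type*} {T : X → X}

/-- The running maximum of the Birkhoff sums of lengths `0, …, n`. -/
def maxBirkhoff (T : X → X) (g : X → ℝ) : ℕ → X → ℝ
  | 0, _ => 0
  | n + 1, x => max 0 (g x + maxBirkhoff T g n (T x))

theorem maxBirkhoff_nonneg (g : X → ℝ) (n : ℕ) (x : X) : 0 ≤ maxBirkhoff T g n x := by
  cases n with
  | zero => exact le_rfl
  | succ n => exact le_max_left _ _

theorem maxBirkhoff_mono (g : X → ℝ) (x : X) : Monotone fun n => maxBirkhoff T g n x := by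
  refine monotone_nat_of_le_succ fun n => ?_
  induction n generalizing x with
  | zero => exact maxBirkhoff_nonneg g 1 x
  | succ n ih => exact max_le_max le_rfl (add_le_add le_rfl (ih (T x)))

theorem birkhoffSum_le_maxBirkhoff (g : X → ℝ) (n : ℕ) (x : X) :
    birkhoffSum T g n x ≤ maxBirkhoff T g n x := by
  induction n generalizing x with
  | zero => simp [maxBirkhoff]
  | succ n ih =>
    rw [birkhoffSum_succ']
    exact (add_le_add le_rfl (ih (T x))).trans (le_max_right _ _)

theorem measurable_maxBirkhoff [MeasurableSpace X] (hT : Measurable T) {g : X → ℝ}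
    (hg : Measurable g) (n : ℕ) :
    Measurable (maxBirkhoff T g n) := by
  induction n with
  | zero => exact measurable_const
  | succ n ih => exact measurable_const.max (hg.add (ih.comp hT))

theorem maxBirkhoff_le {g : X → ℝ} {C : ℝ} (hC : ∀ x, |g x| ≤ C) (n : ℕ) (x : X) :
    maxBirkhoff T g n x ≤ n * C := by
  have hC0 : 0 ≤ C := (abs_nonneg _).trans (hC x)
  induction n generalizing x with
  | zero => simp [maxBirkhoff]
  | succ n ih =>
    have h1 := ih (T x)
    have h2 := (abs_le.1 (hC x)).2
    refine max_le (by positivity) ?_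
    push_cast
    linarith

variable [MeasurableSpace X] {μ : Measure X} [IsProbabilityMeasure μ]

/-- For an ergodic map, the Birkhoff sums of a bounded function with negative mean are almost
surely bounded above. -/
theorem ae_exists_birkhoffSum_le (hT : Ergodic T μ) {g : X → ℝ} (hg : Measurable g) {C : ℝ}
    (hC : ∀ x, |g x| ≤ C) (hneg : ∫ x, g x ∂μ < 0) :
    ∀ᵐ x ∂μ, ∃ B : ℝ, ∀ n, birkhoffSum T g n x ≤ B := by
  have hTm := hT.toMeasurePreserving
  set A : Set X := {x | ∃ B : ℕ, ∀ n, maxBirkhoff T g n x ≤ B} with hA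
  have hAm : MeasurableSet A := by
    have : A = ⋃ B : ℕ, ⋂ n, {x | maxBirkhoff T g n x ≤ B} := by
      ext x; simp [hA]
    rw [this]
    exact MeasurableSet.iUnion fun B => MeasurableSet.iInter fun n =>
      measurableSet_le (measurable_maxBirkhoff hTm.measurable hg n) measurable_const
  -- The recursion `M_{n+1} = max 0 (g + M_n ∘ T)` makes boundedness at `x` and at `T x` equivalent.
  have hinv : T ⁻¹' A = A := by
    ext x
    constructor
    · rintro ⟨B, hB⟩
      obtain ⟨B', hB'⟩ := exists_nat_ge (max 0 (g x + B))
      refine ⟨B', fun n => (maxBirkhoff_mono g x (Nat.le_succ n)).trans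
        (le_trans (max_le_max le_rfl (add_le_add le_rfl (hB n))) hB')⟩
    · rintro ⟨B, hB⟩
      obtain ⟨B', hB'⟩ := exists_nat_ge (B - g x)
      refine ⟨B', fun n => ?_⟩
      have : g x + maxBirkhoff T g n (T x) ≤ B := (le_max_right _ _).trans (hB (n + 1))
      linarith
  rcases hT.toPreErgodic.ae_mem_or_ae_notMem hAm hinv with h | h
  · filter_upwards [h] with x hx
    obtain ⟨B, hB⟩ := hx
    exact ⟨B, fun n => (birkhoffSum_le_maxBirkhoff g n x).trans (hB n)⟩
  · exfalso
    have hint : ∀ n, Integrable (maxBirkhoff T g n) μ := fun n =>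
      Integrable.of_bound (measurable_maxBirkhoff hTm.measurable hg n).aestronglyMeasurable (n * C)
        (Eventually.of_forall fun x => by
          rw [Real.norm_of_nonneg (maxBirkhoff_nonneg g n x)]
          exact maxBirkhoff_le hC n x)
    have hcomp : ∀ n, ∫ x, maxBirkhoff T g n (T x) ∂μ = ∫ x, maxBirkhoff T g n x ∂μ := fun n => by
      conv_rhs => rw [← hTm.map_eq]
      rw [integral_map hTm.measurable.aemeasurable]
      exact (measurable_maxBirkhoff hTm.measurable hg n).aestronglyMeasurable
    -- This difference has nonnegative integral, since `T` preserves `μ` and the maxima increase in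
    -- `n`. If the maxima were almost surely unbounded, the right-hand side would eventually equal
    -- `g`, and dominated convergence would give `∫ g ≥ 0`.
    have hdiff : ∀ n x, maxBirkhoff T g (n + 1) x - maxBirkhoff T g n (T x) =
        max (-maxBirkhoff T g n (T x)) (g x) := fun n x => by
      simp only [maxBirkhoff]
      rw [← max_sub_sub_right]
      simp
    have hge : ∀ n, 0 ≤ ∫ x, max (-maxBirkhoff T g n (T x)) (g x) ∂μ := fun n => by
      simp_rw [← hdiff]
      have hintT : Integrable (fun x => maxBirkhoff T g n (T x)) μ :=
        hTm.integrable_comp_of_integrable (hint n)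
      rw [integral_sub (hint (n + 1)) hintT, hcomp,
        ← integral_sub (hint (n + 1)) (hint n)]
      exact integral_nonneg fun x => sub_nonneg.2 (maxBirkhoff_mono g x (Nat.le_succ n))
    have hlim : Tendsto (fun n => ∫ x, max (-maxBirkhoff T g n (T x)) (g x) ∂μ) atTop
        (𝓝 (∫ x, g x ∂μ)) := by
      refine tendsto_integral_of_dominated_convergence (fun _ => C) (fun n => ?_)
        (integrable_const C) (fun n => Eventually.of_forall fun x => ?_) ?_
      · exact ((((measurable_maxBirkhoff hTm.measurable hg n).comp hTm.measurable).neg).max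
          hg).aestronglyMeasurable
      · have h0 := maxBirkhoff_nonneg (T := T) g n (T x)
        have h1 := abs_le.1 (hC x)
        rw [Real.norm_eq_abs, abs_le]
        exact ⟨h1.1.trans (le_max_right _ _), max_le (by linarith) h1.2⟩
      · filter_upwards [h] with x hx
        have hx' : T x ∉ A := fun h' => hx (by rw [← hinv]; exact h')
        have hex : ∃ N, -g x ≤ maxBirkhoff T g N (T x) := by
          by_contra! hcon
          obtain ⟨B, hB⟩ := exists_nat_ge (-g x)
          exact hx' ⟨B, fun n => (hcon n).le.trans hB⟩
        obtain ⟨N, hN⟩ := hex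
        refine tendsto_const_nhds.congr' ?_
        filter_upwards [eventually_ge_atTop N] with n hn
        have := maxBirkhoff_mono (T := T) g (T x) hn
        simp only at this
        rw [max_eq_right (by linarith)]
    exact absurd (ge_of_tendsto' hlim hge) (not_le.2 hneg)

/-- **Pointwise ergodic theorem** for bounded functions. -/
theorem ae_tendsto_birkhoffSum_div (hT : Ergodic T μ) {g : X → ℝ} (hg : Measurable g) {C : ℝ}
    (hC : ∀ x, |g x| ≤ C) :
    ∀ᵐ x ∂μ, Tendsto (fun n : ℕ => birkhoffSum T g n x / n) atTop (𝓝 (∫ y, g y ∂μ)) := by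
  have upper : ∀ {g : X → ℝ}, Measurable g → (∃ C, ∀ x, |g x| ≤ C) →
      ∀ᵐ x ∂μ, ∀ k : ℕ, ∀ᶠ n : ℕ in atTop,
        birkhoffSum T g n x / n ≤ (∫ y, g y ∂μ) + 2 / (k + 1) := by
    rintro g hg ⟨C, hC⟩
    rw [ae_all_iff]
    intro k
    have hk : (0 : ℝ) < 1 / (k + 1) := by positivity
    -- Subtracting slightly more than the mean makes the mean negative, so the sums of `g - e` stay
    -- below some `B`; the second `1 / (k + 1)` in the claim absorbs `B / n`.
    set e : ℝ := (∫ y, g y ∂μ) + 1 / (k + 1) with he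
    have hgi : Integrable g μ := Integrable.of_bound hg.aestronglyMeasurable C
      (Eventually.of_forall hC)
    have := ae_exists_birkhoffSum_le hT (g := fun x => g x - e) (hg.sub_const e) (C := C + |e|)
      (fun x => (abs_sub _ _).trans (add_le_add (hC x) le_rfl))
      (by
        rw [integral_sub hgi (integrable_const e)]
        simp [he]
        positivity)
    filter_upwards [this] with x ⟨B, hB⟩
    obtain ⟨N, hN⟩ := exists_nat_gt (B / (1 / (k + 1)))
    filter_upwards [eventually_ge_atTop (N + 1)] with n hn
    have hn0 : (0 : ℝ) < n := by exact_mod_cast (by omega : 0 < n)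
    have hs : birkhoffSum T (fun x => g x - e) n x = birkhoffSum T g n x - n * e := by
      simp [birkhoffSum]
    have h1 := hB n
    rw [hs] at h1
    have h2 : B < N * (1 / (k + 1)) := by rwa [div_lt_iff₀ hk] at hN
    have h3 : (N : ℝ) * (1 / (k + 1)) ≤ n * (1 / (k + 1)) :=
      mul_le_mul_of_nonneg_right (by exact_mod_cast (by omega : N ≤ n)) hk.le
    rw [div_le_iff₀ hn0]
    have h4 : ((∫ y, g y ∂μ) + 2 / (k + 1)) * n = n * e + n * (1 / (k + 1)) := by
      rw [he]; ring
    linarith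
  -- The lower bound is the upper bound for `-g`.
  filter_upwards [upper hg ⟨C, hC⟩, upper hg.neg ⟨C, fun x => by
    simpa only [Pi.neg_apply, abs_neg] using hC x⟩] with x h1 h2
  rw [Metric.tendsto_atTop']
  intro ε hε
  obtain ⟨k, hk⟩ := exists_nat_gt (2 / ε)
  have hk' : 2 / ((k : ℝ) + 1) < ε := by
    rw [div_lt_iff₀ (by positivity)]
    rw [div_lt_iff₀ hε] at hk
    nlinarith
  obtain ⟨N, hN⟩ := ((h1 k).and (h2 k)).exists_forall_of_atTop
  refine ⟨N, fun n hn => ?_⟩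
  obtain ⟨a, b⟩ := hN n hn.le
  rw [show birkhoffSum T (-g) n x = - birkhoffSum T g n x from birkhoffSum_neg T g n x, neg_div] at b
  simp only [Pi.neg_apply, integral_neg] at b
  rw [Real.dist_eq, abs_lt]
  constructor <;> linarith

end Birkhoff

/-! ### Probability measures on a compact metric space -/

section ProbabilityMeasureTopology

variable {W : Type*} [MetricSpace W] [CompactSpace W] [MeasurableSpace W] [BorelSpace W]

/-- The integrals of the members of a dense sequence of continuous functions. -/
def denseIntegrals (μ : ProbabilityMeasure W) (n : ℕ) : ℝ :=
  ∫ w, TopologicalSpace.denseSeq C(W, ℝ) n w ∂(μ : Measure W)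

theorem continuous_integral_probabilityMeasure (f : C(W, ℝ)) :
    Continuous fun μ : ProbabilityMeasure W => ∫ w, f w ∂(μ : Measure W) := by
  rw [continuous_iff_continuousAt]
  intro μ
  exact ProbabilityMeasure.tendsto_iff_forall_integral_tendsto.1 tendsto_id
    (BoundedContinuousFunction.mkOfCompact f)

/-- A continuous injection of a compact space into a Hausdorff space is a closed embedding.
Injectivity holds because `f ↦ ∫ f dμ` is continuous and so determined by a dense sequence. This
yields second countability and the measurability of weakly open sets. -/
theorem isClosedEmbedding_denseIntegrals :
    IsClosedEmbedding (denseIntegrals : ProbabilityMeasure W → ℕ → ℝ) := by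
  refine Continuous.isClosedEmbedding (continuous_pi fun n =>
    continuous_integral_probabilityMeasure _) fun μ ν h => ?_
  refine Subtype.ext (show (μ : Measure W) = (ν : Measure W) from
    ext_of_forall_integral_eq_of_IsFiniteMeasure fun f => ?_)
  have hcont : ∀ μ : ProbabilityMeasure W,
      Continuous fun f : C(W, ℝ) => ∫ w, f w ∂(μ : Measure W) := fun μ => by
    rw [Metric.continuous_iff]
    intro f ε hε
    refine ⟨ε, hε, fun g hg => ?_⟩
    rw [dist_eq_norm, ← integral_sub]
    · refine lt_of_le_of_lt (norm_integral_le_of_norm_le_const (C := dist g f)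
        (Eventually.of_forall fun w => ?_)) (by simpa using hg)
      rw [← dist_eq_norm]
      exact ContinuousMap.dist_apply_le_dist w
    · exact (map_continuous g).integrable_of_hasCompactSupport (HasCompactSupport.of_compactSpace _)
    · exact (map_continuous f).integrable_of_hasCompactSupport (HasCompactSupport.of_compactSpace _)
  have := (TopologicalSpace.denseRange_denseSeq C(W, ℝ)).equalizer (hcont μ) (hcont ν)
    (funext fun n => congrFun h n)
  exact congrFun this f.toContinuousMap

instance : SecondCountableTopology (ProbabilityMeasure W) :=
  isClosedEmbedding_denseIntegrals.isEmbedding.secondCountableTopology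

theorem measurable_integral_probabilityMeasure (f : C(W, ℝ)) :
    Measurable fun μ : ProbabilityMeasure W => ∫ w, f w ∂(μ : Measure W) := by
  have hle : ∀ μ : ProbabilityMeasure W, ∫ w, f w ∂(μ : Measure W) =
      (∫⁻ w, ENNReal.ofReal (f w) ∂(μ : Measure W)).toReal -
        (∫⁻ w, ENNReal.ofReal (-f w) ∂(μ : Measure W)).toReal := fun μ =>
    integral_eq_lintegral_pos_part_sub_lintegral_neg_part
      ((map_continuous f).integrable_of_hasCompactSupport (HasCompactSupport.of_compactSpace _))
  simp_rw [hle]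
  have hm := (map_continuous f).measurable
  exact ((Measure.measurable_lintegral hm.ennreal_ofReal).comp
    measurable_subtype_coe).ennreal_toReal.sub
    ((Measure.measurable_lintegral hm.neg.ennreal_ofReal).comp
      measurable_subtype_coe).ennreal_toReal

/-- Weakly open sets are preimages of open sets of `ℝ^ℕ` under `denseIntegrals`, whose coordinates
are measurable for the σ-algebra generated by the evaluations. -/
instance : OpensMeasurableSpace (ProbabilityMeasure W) := by
  refine ⟨MeasurableSpace.generateFrom_le fun U hU => ?_⟩
  obtain ⟨V, hV, rfl⟩ := isClosedEmbedding_denseIntegrals.isInducing.isOpen_iff.1 hU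
  exact (measurable_pi_lambda _ fun n => measurable_integral_probabilityMeasure _) hV.measurableSet

end ProbabilityMeasureTopology

/-! ### Blow-ups -/

namespace Scenery

theorem measurableEmbedding_affine (x : ℝ) {a : ℝ} (ha : a ≠ 0) :
    MeasurableEmbedding fun y : Window => x + a * (y : ℝ) :=
  (((Homeomorph.mulLeft₀ a ha).trans (Homeomorph.addLeft x)).measurableEmbedding).comp
    (MeasurableEmbedding.subtype_coe measurableSet_Icc)

/-- The measure `E ↦ ν (x + a * E)` on `[-1,1]`. -/
def pullback (ν : Measure ℝ) (x a : ℝ) : Measure Window :=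
  Measure.comap (fun y : Window => x + a * (y : ℝ)) ν

instance (ν : Measure ℝ) [IsFiniteMeasure ν] (x a : ℝ) : IsFiniteMeasure (pullback ν x a) := by
  unfold pullback; infer_instance

theorem affine_image_eq (x : ℝ) {a : ℝ} (ha : a ≠ 0) (E : Set Window) :
    (fun y : Window => x + a * (y : ℝ)) '' E = {z : ℝ | (z - x) / a ∈ Subtype.val '' E} := by
  ext z
  simp only [mem_image, mem_ofPred_eq]
  refine exists_congr fun y => and_congr_right fun _ => ?_
  rw [eq_div_iff ha]
  constructor <;> intro h <;> linarith

theorem pullback_apply (ν : Measure ℝ) (x : ℝ) {a : ℝ} (ha : a ≠ 0) (E : Set Window) :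
    pullback ν x a E = ν {z : ℝ | (z - x) / a ∈ Subtype.val '' E} := by
  rw [pullback, (measurableEmbedding_affine x ha).comap_apply, affine_image_eq x ha]

/-- `pullback` as a finite measure. -/
def pullbackFinite (ν : Measure ℝ) [IsFiniteMeasure ν] (x a : ℝ) : FiniteMeasure Window :=
  ⟨pullback ν x a, inferInstance⟩

theorem coe_blowUp {ν : Measure ℝ} [IsFiniteMeasure ν] {x a : ℝ} (h : pullback ν x a univ ≠ 0) :
    (blowUp ν x a : Measure Window) = (pullback ν x a univ)⁻¹ • pullback ν x a := by
  have h0 : pullbackFinite ν x a ≠ 0 := by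
    intro h'
    apply h
    have := congrArg (fun m : FiniteMeasure Window => (m : Measure Window) univ) h'
    exact this
  have := FiniteMeasure.toMeasure_normalize_eq_of_nonzero _ h0
  refine this.trans ?_
  ext E hE
  rw [Measure.smul_apply, Measure.smul_apply, ENNReal.smul_def,
    ENNReal.coe_inv ((FiniteMeasure.mass_nonzero_iff _).2 h0), FiniteMeasure.ennreal_mass]
  rfl

theorem blowUp_of_pullback_eq_zero {ν : Measure ℝ} [IsFiniteMeasure ν] {x a : ℝ}
    (h : pullback ν x a univ = 0) : blowUp ν x a = FiniteMeasure.normalize 0 := by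
  have : pullbackFinite ν x a = 0 := by
    apply Subtype.ext
    exact Measure.measure_univ_eq_zero.1 h
  exact congrArg FiniteMeasure.normalize this

theorem blowUp_eq_of_pullback {ν ν' : Measure ℝ} [IsFiniteMeasure ν] [IsFiniteMeasure ν']
    {x a x' a' : ℝ} {c : ENNReal} (hc : c ≠ 0) (hc' : c ≠ ⊤)
    (h : pullback ν x a = c • pullback ν' x' a') : blowUp ν x a = blowUp ν' x' a' := by
  by_cases h0 : pullback ν' x' a' univ = 0
  -- If one pullback vanishes then so does the other, and both sides take the default value
  -- `normalize 0`.
  · rw [blowUp_of_pullback_eq_zero h0, blowUp_of_pullback_eq_zero (by rw [h]; simp [h0])]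
  · apply Subtype.ext
    have h1 : pullback ν x a univ ≠ 0 := by rw [h]; simp [h0, hc]
    refine (coe_blowUp h1).trans (Eq.trans ?_ (coe_blowUp h0).symm)
    rw [h, smul_smul, Measure.smul_apply, smul_eq_mul]
    congr 1
    rw [ENNReal.mul_inv (Or.inl hc) (Or.inl hc'), mul_right_comm, ENNReal.inv_mul_cancel hc hc',
      one_mul]

/-- A blow-up of a blow-up is a blow-up. -/
theorem blowUp_blowUp {ν : Measure ℝ} [IsFiniteMeasure ν] {x a b : ℝ}
    (h : pullback ν x a univ ≠ 0) (ha : a ≠ 0) (hb : b ≠ 0) (hb1 : |b| ≤ 1) :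
    blowUp (toReal (blowUp ν x a)) 0 b = blowUp ν x (a * b) := by
  suffices hp : pullback (toReal (blowUp ν x a)) 0 b =
      (pullback ν x a univ)⁻¹ • pullback ν x (a * b) from
    blowUp_eq_of_pullback (ENNReal.inv_ne_zero.2 (measure_ne_top _ _)) (ENNReal.inv_ne_top.2 h) hp
  refine Measure.ext fun E hE => ?_
  have hmE : MeasurableSet {z : ℝ | (z - 0) / b ∈ Subtype.val '' E} :=
    ((measurable_id.sub_const 0).div_const b)
      ((MeasurableEmbedding.subtype_coe measurableSet_Icc).measurableSet_image.2 hE)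
  rw [pullback_apply _ _ hb, toReal, Measure.map_apply measurable_subtype_coe hmE, coe_blowUp h,
    Measure.smul_apply, Measure.smul_apply, pullback_apply _ _ ha (Subtype.val ⁻¹' _),
    pullback_apply _ _ (mul_ne_zero ha hb)]
  refine congrArg (fun s => (pullback ν x a univ)⁻¹ • ν s) (Set.ext fun z => ?_)
  simp only [mem_image, mem_preimage, mem_ofPred_eq, sub_zero]
  constructor
  · rintro ⟨y, ⟨e, he, hey⟩, hyz⟩
    exact ⟨e, he, by rw [hey, hyz, div_div]⟩
  · rintro ⟨e, he, hez⟩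
    rw [← div_div, eq_div_iff hb] at hez
    -- This is where `|b| ≤ 1` matters: the smaller window lies inside the larger one, so
    -- restricting first loses nothing.
    have habs : |(z - x) / a| ≤ 1 := by
      rw [← hez, abs_mul]
      exact mul_le_one₀ (abs_le.2 e.2) (abs_nonneg _) hb1
    exact ⟨⟨(z - x) / a, abs_le.1 habs⟩, ⟨e, he, by rw [eq_div_iff hb]; exact hez⟩, rfl⟩

theorem pullback_univ_ne_zero {ν : Measure ℝ} {x a : ℝ} (hx : x ∈ ν.support) (ha : a ≠ 0) :
    pullback ν x a univ ≠ 0 := by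
  rw [pullback_apply _ _ ha]
  have hn : {z : ℝ | (z - x) / a ∈ Subtype.val '' (univ : Set Window)} ∈ 𝓝 x := by
    rw [image_univ, Subtype.range_coe]
    have : ContinuousAt (fun z : ℝ => (z - x) / a) x := by fun_prop
    refine this (Icc_mem_nhds ?_ ?_) <;> simp
  exact ((Measure.mem_support_iff_forall _).1 hx _ hn).ne'

theorem origin_mem_support_blowUp {ν : Measure ℝ} [IsFiniteMeasure ν] {x a : ℝ}
    (hx : x ∈ ν.support) (ha : a ≠ 0) :
    origin ∈ (blowUp ν x a : Measure Window).support := by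
  rw [Measure.mem_support_iff_forall]
  intro U hU
  rw [coe_blowUp (pullback_univ_ne_zero hx ha), Measure.smul_apply, smul_eq_mul]
  refine ENNReal.mul_pos (ENNReal.inv_ne_zero.2 (measure_ne_top _ _)) ?_
  rw [pullback_apply _ _ ha]
  obtain ⟨V, hV, hVU⟩ := (mem_nhds_subtype _ _ _).1 hU
  have hc : ContinuousAt (fun z : ℝ => (z - x) / a) x := by fun_prop
  have h1 : V ∈ 𝓝 ((x - x) / a) := by simpa [origin] using hV
  have h2 : Icc (-1 : ℝ) 1 ∈ 𝓝 ((x - x) / a) := Icc_mem_nhds (by simp) (by simp)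
  have h3 := hc (inter_mem h1 h2)
  refine (lt_of_lt_of_le ((Measure.mem_support_iff_forall _).1 hx _ h3) (measure_mono ?_)).ne'
  exact fun z hz => ⟨⟨(z - x) / a, hz.2⟩, hVU hz.1, rfl⟩

theorem measurable_toProbabilityMeasure {α : Type*} [MeasurableSpace α]
    {f : α → ProbabilityMeasure Window}
    (hf : ∀ E : Set Window, MeasurableSet E → Measurable fun θ => (f θ : Measure Window) E) :
    Measurable f :=
  (Measure.measurable_of_measurable_coe (fun θ => (f θ : Measure Window)) hf).subtype_mk

theorem measurable_eval {E : Set Window} (hE : MeasurableSet E) :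
    Measurable fun μ : ProbabilityMeasure Window => (μ : Measure Window) E :=
  (Measure.measurable_coe hE).comp measurable_subtype_coe

theorem measurable_blowUp {α : Type*} [MeasurableSpace α] {ν : α → Measure ℝ}
    [∀ θ, IsProbabilityMeasure (ν θ)] (hν : Measurable ν) {x a : α → ℝ} (hx : Measurable x)
    (ha : Measurable a) (ha0 : ∀ θ, a θ ≠ 0) :
    Measurable fun θ => blowUp (ν θ) (x θ) (a θ) := by
  have hD : ∀ E : Set Window, MeasurableSet E →
      Measurable fun θ => pullback (ν θ) (x θ) (a θ) E := fun E hE => by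
    simp_rw [pullback_apply _ _ (ha0 _)]
    let κ : ProbabilityTheory.Kernel α ℝ := ⟨ν, hν⟩
    have : ProbabilityTheory.IsMarkovKernel κ := ⟨fun θ => inferInstanceAs
      (IsProbabilityMeasure (ν θ))⟩
    have hm : MeasurableSet {p : α × ℝ | (p.2 - x p.1) / a p.1 ∈ Subtype.val '' E} :=
      ((measurable_snd.sub (hx.comp measurable_fst)).div (ha.comp measurable_fst))
        ((MeasurableEmbedding.subtype_coe measurableSet_Icc).measurableSet_image.2 hE)
    exact ProbabilityTheory.Kernel.measurable_kernel_prodMk_left (κ := κ) hm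
  refine measurable_toProbabilityMeasure fun E hE => ?_
  -- Normalization takes a constant default value where the window has mass zero, so measurability
  -- is checked by cases.
  have hval : ∀ θ, (blowUp (ν θ) (x θ) (a θ) : Measure Window) E =
      if pullback (ν θ) (x θ) (a θ) univ = 0 then
        ((FiniteMeasure.normalize 0 : ProbabilityMeasure Window) : Measure Window) E
      else (pullback (ν θ) (x θ) (a θ) univ)⁻¹ * pullback (ν θ) (x θ) (a θ) E := fun θ => by
    split_ifs with h
    · rw [blowUp_of_pullback_eq_zero h]
    · rw [coe_blowUp h]; rfl
  simp_rw [hval]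
  exact Measurable.ite (hD univ MeasurableSet.univ (measurableSet_singleton 0)) measurable_const
    ((hD univ MeasurableSet.univ).inv.mul (hD E hE))

instance (μ : ProbabilityMeasure Window) : IsProbabilityMeasure (toReal μ) :=
  Measure.isProbabilityMeasure_map measurable_subtype_coe.aemeasurable

theorem measurable_toReal : Measurable (toReal : ProbabilityMeasure Window → Measure ℝ) :=
  (Measure.measurable_map _ measurable_subtype_coe).comp measurable_subtype_coe

theorem measurable_scale_comp {α : Type*} [MeasurableSpace α] {f : α → ℝ}
    {g : α → ProbabilityMeasure Window} (hf : Measurable f) (hg : Measurable g) :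
    Measurable fun θ => scale (f θ) (g θ) :=
  measurable_blowUp (ν := fun θ => toReal (g θ)) (x := fun _ => 0)
    (a := fun θ => Real.exp (-f θ)) (measurable_toReal.comp hg) measurable_const
    (Real.measurable_exp.comp hf.neg) fun _ => (Real.exp_pos _).ne'

theorem measurable_scale (t : ℝ) : Measurable (scale t) :=
  measurable_scale_comp (g := fun μ => μ) measurable_const measurable_id

theorem measurable_reflect : Measurable reflect :=
  measurable_blowUp (ν := fun μ : ProbabilityMeasure Window => toReal μ) (x := fun _ => 0)
    (a := fun _ => -1) measurable_toReal measurable_const measurable_const fun _ => by norm_num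

theorem scale_blowUp {ν : Measure ℝ} [IsFiniteMeasure ν] {x a t : ℝ} (hx : x ∈ ν.support)
    (ha : a ≠ 0) (ht : 0 ≤ t) :
    scale t (blowUp ν x a) = blowUp ν x (a * Real.exp (-t)) :=
  blowUp_blowUp (pullback_univ_ne_zero hx ha) ha (Real.exp_pos _).ne' (by
    rw [abs_of_pos (Real.exp_pos _)]
    exact Real.exp_le_one_iff.2 (by linarith))

theorem reflect_blowUp {ν : Measure ℝ} [IsFiniteMeasure ν] {x a : ℝ} (hx : x ∈ ν.support)
    (ha : a ≠ 0) : reflect (blowUp ν x a) = blowUp ν x (a * -1) :=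
  blowUp_blowUp (pullback_univ_ne_zero hx ha) ha (by norm_num) (by norm_num)

theorem measurableSet_centered : MeasurableSet Centered := by
  have : Centered = ⋂ n : ℕ, {μ : ProbabilityMeasure Window |
      (μ : Measure Window) (Metric.ball origin (1 / (n + 1))) ≠ 0} := by
    ext μ
    simp only [Centered, mem_ofPred_eq, mem_iInter,
      Measure.mem_support_iff_forall]
    constructor
    · exact fun h n => (h _ (Metric.ball_mem_nhds _ (by positivity))).ne'
    · intro h U hU
      obtain ⟨ε, hε, hU⟩ := Metric.mem_nhds_iff.1 hU
      obtain ⟨n, hn⟩ := exists_nat_one_div_lt hε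
      exact lt_of_lt_of_le (pos_iff_ne_zero.2 (h n))
        (measure_mono ((Metric.ball_subset_ball hn.le).trans hU))
  rw [this]
  exact MeasurableSet.iInter fun n =>
    (measurable_eval Metric.isOpen_ball.measurableSet) (measurableSet_singleton 0).compl

theorem measurableSet_origin_null : MeasurableSet {μ : ProbabilityMeasure Window |
    (μ : Measure Window) {origin} = 0} := by
  have h : Measurable fun μ : ProbabilityMeasure Window => (μ : Measure Window) {origin} :=
    measurable_eval (measurableSet_singleton _)
  exact h (measurableSet_singleton 0)

/-- The origin of the window corresponds to the centre `x` alone. This is what separates the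
generated distribution from the trivial one. -/
theorem blowUp_origin_eq_zero {ν : Measure ℝ} [IsFiniteMeasure ν] {x a : ℝ}
    (hx : x ∈ ν.support) (ha : a ≠ 0) (hν : ν {x} = 0) :
    (blowUp ν x a : Measure Window) {origin} = 0 := by
  rw [coe_blowUp (pullback_univ_ne_zero hx ha), Measure.smul_apply,
    pullback_apply _ _ ha {origin}]
  have : {z : ℝ | (z - x) / a ∈ Subtype.val '' ({origin} : Set Window)} = {x} := by
    ext z
    simp [origin, ha, sub_eq_zero, eq_comm]
  rw [this, hν, smul_zero]

end Scenery

/-! ### Functions along the orbits of a suspension semiflow -/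

section Interpolation

/-- A Lipschitz function whose means converge along a sequence with increments bounded above and
below has convergent means. -/
theorem tendsto_mean_of_tendsto_subsequence {a : ℕ → ℝ} {c R C L : ℝ} {F : ℝ → ℝ} (hc : 0 < c)
    (ha0 : a 0 = 0) (hac : ∀ n, c ≤ a (n + 1) - a n) (haR : ∀ n, a (n + 1) - a n ≤ R)
    (hF : ∀ s t, 0 ≤ s → s ≤ t → |F t - F s| ≤ C * (t - s))
    (hL : Tendsto (fun n => F (a n) / a n) atTop (𝓝 L)) :
    Tendsto (fun T : ℝ => T⁻¹ * F T) atTop (𝓝 L) := by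
  have hlow : ∀ n : ℕ, n * c ≤ a n := fun n => by
    induction n with
    | zero => simp [ha0]
    | succ n ih => have := hac n; push_cast; linarith
  have hup : ∀ n : ℕ, a n ≤ n * R := fun n => by
    induction n with
    | zero => simp [ha0]
    | succ n ih => have := haR n; push_cast; linarith
  have hR : 0 < R := hc.trans_le ((hac 0).trans (haR 0))
  -- The index of the last return before `T`. The guard `0 ≤ T` sits inside the existential so that
  -- `choose` produces a function of `T` alone.
  have hex : ∀ T : ℝ, ∃ n, 0 ≤ T → a n ≤ T ∧ T < a (n + 1) := fun T => by
    classical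
    have hbig : ∃ n, T < a n := by
      obtain ⟨n, hn⟩ := exists_nat_gt (T / c)
      exact ⟨n, lt_of_lt_of_le ((div_lt_iff₀ hc).1 hn) (hlow n)⟩
    cases hN : Nat.find hbig with
    | zero =>
      refine ⟨0, fun hT => ?_⟩
      have := Nat.find_spec hbig
      rw [hN, ha0] at this
      exact absurd hT (not_le.2 this)
    | succ n =>
      refine ⟨n, fun _ => ⟨not_lt.1 (Nat.find_min hbig (by omega)), ?_⟩⟩
      have := Nat.find_spec hbig
      rwa [hN] at this
  choose n hn using hex
  have hn_top : Tendsto n atTop atTop := by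
    rw [tendsto_atTop]
    intro k
    filter_upwards [eventually_ge_atTop (0 : ℝ), eventually_ge_atTop ((k : ℝ) * R)] with T h0 hk
    by_contra! hlt
    have h1 := (hn T h0).2.trans_le (hup _)
    have h2 : ((n T + 1 : ℕ) : ℝ) * R ≤ k * R :=
      mul_le_mul_of_nonneg_right (by exact_mod_cast hlt) hR.le
    linarith
  have hratio : Tendsto (fun T => a (n T) / T) atTop (𝓝 1) := by
    have hz : Tendsto (fun T : ℝ => 1 - R / T) atTop (𝓝 1) := by
      simpa using (tendsto_const_nhds (x := (1 : ℝ))).sub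
        ((tendsto_const_nhds (x := R)).div_atTop tendsto_id)
    refine tendsto_of_tendsto_of_tendsto_of_le_of_le' hz tendsto_const_nhds ?_ ?_
    · filter_upwards [eventually_gt_atTop (0 : ℝ)] with T hT
      obtain ⟨h1, h2⟩ := hn T hT.le
      have h3 := haR (n T)
      rw [le_div_iff₀ hT, sub_mul, div_mul_cancel₀ _ hT.ne']
      linarith
    · filter_upwards [eventually_gt_atTop (0 : ℝ)] with T hT
      rw [div_le_one hT]
      exact (hn T hT.le).1
  have herr : Tendsto (fun T => (F T - F (a (n T))) / T) atTop (𝓝 0) := by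
    have hz : Tendsto (fun T : ℝ => |C| * R / T) atTop (𝓝 0) :=
      (tendsto_const_nhds (x := |C| * R)).div_atTop tendsto_id
    refine squeeze_zero_norm' ?_ hz
    filter_upwards [eventually_gt_atTop (0 : ℝ)] with T hT
    obtain ⟨h1, h2⟩ := hn T hT.le
    have h3 := haR (n T)
    have h4 : 0 ≤ a (n T) := le_trans (by positivity) (hlow _)
    rw [norm_div, Real.norm_eq_abs, Real.norm_of_nonneg hT.le]
    refine div_le_div_of_nonneg_right ((hF _ _ h4 h1).trans ?_) hT.le
    exact mul_le_mul (le_abs_self C) (by linarith) (by linarith) (abs_nonneg C)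
  have hmain := ((hL.comp hn_top).mul hratio).add herr
  rw [mul_one, add_zero] at hmain
  refine hmain.congr' ?_
  filter_upwards [eventually_gt_atTop (0 : ℝ), hn_top.eventually_ge_atTop 1] with T hT h1
  have h2 : 0 < a (n T) := lt_of_lt_of_le (by positivity) (hlow _)
  simp only [Function.comp]
  field_simp
  ring

end Interpolation

namespace Suspension

variable {X : Type*} [MeasurableSpace X]

/-- A bounded measurable function of the position in the suspension semiflow over `T` with roof
`ρ`, where a position is described by a base point and the time since passing it. -/
structure IsOrbital (m : Measure X) (T : X → X) (ρ : X → ℝ) (Φ : X → ℝ → ℝ) (C : ℝ) : Prop where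
  measurable : Measurable (Function.uncurry Φ)
  bound : ∀ x s, |Φ x s| ≤ C
  jump : ∀ᵐ x ∂m, ∀ w, 0 ≤ w → Φ x (ρ x + w) = Φ (T x) w

/-- A measurable roof function with bounds. -/
structure IsRoof (ρ : X → ℝ) (c R : ℝ) : Prop where
  measurable : Measurable ρ
  pos : 0 < c
  lower : ∀ x, c ≤ ρ x
  upper : ∀ x, ρ x ≤ R

section

variable {m : Measure X} {T : X → X} {ρ : X → ℝ} {Φ : X → ℝ → ℝ} {c C R : ℝ}

theorem IsRoof.nonneg (h : IsRoof ρ c R) (x : X) : 0 ≤ ρ x := h.pos.le.trans (h.lower x)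

theorem IsRoof.abs_le (h : IsRoof ρ c R) (x : X) : |ρ x| ≤ R := by
  rw [abs_of_nonneg (h.nonneg x)]; exact h.upper x

theorem IsRoof.integrable [IsFiniteMeasure m] (h : IsRoof ρ c R) : Integrable ρ m :=
  Integrable.of_bound h.measurable.aestronglyMeasurable R (Eventually.of_forall h.abs_le)

theorem IsRoof.integral_pos [IsProbabilityMeasure m] (h : IsRoof ρ c R) : 0 < ∫ x, ρ x ∂m := by
  have : ∫ _x, c ∂m ≤ ∫ x, ρ x ∂m := integral_mono (integrable_const c) h.integrable h.lower
  simp only [integral_const, probReal_univ, one_smul] at this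
  exact h.pos.trans_le this

theorem measurable_section (hΦ : Measurable (Function.uncurry Φ)) (x : X) : Measurable (Φ x) :=
  hΦ.comp (measurable_const.prodMk measurable_id)

theorem intervalIntegrable_section (hΦ : Measurable (Function.uncurry Φ))
    (hC : ∀ x s, |Φ x s| ≤ C)
    (x : X) (a b : ℝ) : IntervalIntegrable (Φ x) volume a b :=
  (intervalIntegrable_const (c := C)).mono_fun
    (measurable_section hΦ x).aestronglyMeasurable
    (Eventually.of_forall fun s => (hC x s).trans (le_abs_self C))

theorem measurable_integral_section (hΦ : Measurable (Function.uncurry Φ)) {b : X → ℝ}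
    (hb : Measurable b) (hb0 : ∀ x, 0 ≤ b x) : Measurable fun x => ∫ s in (0 : ℝ)..b x, Φ x s := by
  have hset : MeasurableSet {z : X × ℝ | 0 < z.2 ∧ z.2 ≤ b z.1} :=
    (measurableSet_lt measurable_const measurable_snd).inter
      (measurableSet_le measurable_snd (hb.comp measurable_fst))
  have h := (((hΦ.indicator hset).stronglyMeasurable).integral_prod_right'
    (ν := (volume : Measure ℝ))).measurable
  convert h using 2 with x
  rw [intervalIntegral.integral_of_le (hb0 x), ← integral_indicator measurableSet_Ioc]
  rfl

theorem abs_integral_section_le {X : Type*} {Φ : X → ℝ → ℝ} (hC : ∀ x s, |Φ x s| ≤ C) (x : X) (a b : ℝ) :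
    |∫ s in a..b, Φ x s| ≤ C * |b - a| := by
  rw [← Real.norm_eq_abs]
  exact intervalIntegral.norm_integral_le_of_norm_le_const fun s _ => hC x s

theorem integrable_integral_section [IsFiniteMeasure m]
    (hΦ : Measurable (Function.uncurry Φ)) (hC : ∀ x s, |Φ x s| ≤ C) {b : X → ℝ} {B : ℝ}
    (hb : Measurable b) (hb0 : ∀ x, 0 ≤ b x) (hB : ∀ x, b x ≤ B) :
    Integrable (fun x => ∫ s in (0 : ℝ)..b x, Φ x s) m := by
  refine Integrable.of_bound (measurable_integral_section hΦ hb hb0).aestronglyMeasurable (C * B)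
    (Eventually.of_forall fun x => (abs_integral_section_le hC x 0 (b x)).trans ?_)
  have : 0 ≤ C := (abs_nonneg _).trans (hC x 0)
  rw [sub_zero, abs_of_nonneg (hb0 x)]
  exact mul_le_mul_of_nonneg_left (hB x) this

/-- The mean of an orbital function over the region under the roof is invariant in time. -/
theorem IsOrbital.integral_translate [IsProbabilityMeasure m] (hT : MeasurePreserving T m m)
    (hρ : IsRoof ρ c R) (hΦ : IsOrbital m T ρ Φ C) {t : ℝ} (ht : 0 ≤ t) :
    ∫ x, (∫ s in (0 : ℝ)..ρ x, Φ x (s + t)) ∂m = ∫ x, (∫ s in (0 : ℝ)..ρ x, Φ x s) ∂m := by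
  -- Split `[t, ρ + t]` as `[0, ρ]` plus `[ρ, ρ + t]` minus `[0, t]`; the middle piece is `[0, t]`
  -- over `T x`, and the last two have equal means because `T` preserves `m`.
  have hpt : ∀ᵐ x ∂m, ∫ s in (0 : ℝ)..ρ x, Φ x (s + t) =
      (∫ s in (0 : ℝ)..ρ x, Φ x s) + (∫ s in (0 : ℝ)..t, Φ (T x) s) - ∫ s in (0 : ℝ)..t, Φ x s := by
    filter_upwards [hΦ.jump] with x hx
    have hi := intervalIntegrable_section hΦ.measurable hΦ.bound x
    have e1 : ∫ s in (0 : ℝ)..t, Φ (T x) s = ∫ s in ρ x..(ρ x + t), Φ x s := by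
      have : ∫ s in (0 : ℝ)..t, Φ x (ρ x + s) = ∫ s in ρ x..(ρ x + t), Φ x s := by
        rw [intervalIntegral.integral_comp_add_left (Φ x), add_zero]
      rw [← this]
      refine intervalIntegral.integral_congr fun s hs => ?_
      rw [uIcc_of_le ht] at hs
      exact (hx s hs.1).symm
    rw [intervalIntegral.integral_comp_add_right (Φ x), zero_add, e1,
      intervalIntegral.integral_add_adjacent_intervals (hi _ _) (hi _ _),
      intervalIntegral.integral_interval_sub_left (hi _ _) (hi _ _)]
  have hI1 : Integrable (fun x => ∫ s in (0 : ℝ)..ρ x, Φ x s) m :=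
    integrable_integral_section hΦ.measurable hΦ.bound hρ.measurable hρ.nonneg hρ.upper
  have hI2 : Integrable (fun x => ∫ s in (0 : ℝ)..t, Φ x s) m :=
    integrable_integral_section hΦ.measurable hΦ.bound measurable_const (fun _ => ht) fun _ => le_rfl
  have hI3 : Integrable (fun x => ∫ s in (0 : ℝ)..t, Φ (T x) s) m :=
    hT.integrable_comp_of_integrable hI2
  have e3 : ∫ x, (∫ s in (0 : ℝ)..t, Φ (T x) s) ∂m = ∫ x, (∫ s in (0 : ℝ)..t, Φ x s) ∂m := by
    conv_rhs => rw [← hT.map_eq]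
    rw [integral_map hT.measurable.aemeasurable]
    rw [hT.map_eq]
    exact hI2.aestronglyMeasurable
  have hI13 : Integrable (fun x => (∫ s in (0 : ℝ)..ρ x, Φ x s) + ∫ s in (0 : ℝ)..t, Φ (T x) s) m :=
    hI1.add hI3
  rw [integral_congr_ae hpt, integral_sub hI13 hI2, integral_add hI1 hI3, e3, add_sub_cancel_right]

theorem ae_forall_iterate (hT : MeasurePreserving T m m) {p : X → Prop} (h : ∀ᵐ x ∂m, p x) :
    ∀ᵐ x ∂m, ∀ n, p (T^[n] x) :=
  ae_all_iff.2 fun n => (hT.iterate n).quasiMeasurePreserving.ae h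

theorem jump_iterate {X Z : Type*} {T : X → X} {ρ : X → ℝ} {N : X → ℝ → Z} {x : X}
    (hρ : ∀ x, 0 ≤ ρ x)
    (hx : ∀ n, ∀ w, 0 ≤ w → N (T^[n] x) (ρ (T^[n] x) + w) = N (T (T^[n] x)) w) (n : ℕ) :
    ∀ w, 0 ≤ w → N x (birkhoffSum T ρ n x + w) = N (T^[n] x) w := by
  induction n with
  | zero => intro w _; simp
  | succ n ih =>
    intro w hw
    rw [birkhoffSum_succ, add_assoc, ih _ (add_nonneg (hρ _) hw), hx n w hw,
      Function.iterate_succ_apply']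

/-- Orbital functions equidistribute along almost every orbit. -/
theorem IsOrbital.ae_tendsto_mean [IsProbabilityMeasure m] (hT : Ergodic T m)
    (hρ : IsRoof ρ c R) (hΦ : IsOrbital m T ρ Φ C) :
    ∀ᵐ x ∂m, Tendsto (fun t : ℝ => t⁻¹ * ∫ s in (0 : ℝ)..t, Φ x s) atTop
      (𝓝 ((∫ x, ρ x ∂m)⁻¹ * ∫ x, (∫ s in (0 : ℝ)..ρ x, Φ x s) ∂m)) := by
  have hG : ∀ x, |∫ s in (0 : ℝ)..ρ x, Φ x s| ≤ C * R := fun x => by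
    refine (abs_integral_section_le hΦ.bound x 0 (ρ x)).trans ?_
    rw [sub_zero]
    exact mul_le_mul_of_nonneg_left (hρ.abs_le x) ((abs_nonneg _).trans (hΦ.bound x 0))
  filter_upwards [ae_forall_iterate hT.toMeasurePreserving hΦ.jump,
    ae_tendsto_birkhoffSum_div hT (measurable_integral_section hΦ.measurable hρ.measurable
      hρ.nonneg) hG, ae_tendsto_birkhoffSum_div hT hρ.measurable hρ.abs_le] with x hx h1 h2
  have hi := intervalIntegrable_section hΦ.measurable hΦ.bound x
  -- At return times the time average is a quotient of two Birkhoff sums, each governed by the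
  -- pointwise ergodic theorem.
  have hsum : ∀ n, ∫ s in (0 : ℝ)..birkhoffSum T ρ n x, Φ x s =
      birkhoffSum T (fun x => ∫ s in (0 : ℝ)..ρ x, Φ x s) n x := fun n => by
    induction n with
    | zero => simp
    | succ n ih =>
      rw [birkhoffSum_succ, birkhoffSum_succ, ← ih,
        ← intervalIntegral.integral_add_adjacent_intervals (hi _ _) (hi _ _)]
      congr 1
      have : ∫ s in (0 : ℝ)..ρ (T^[n] x), Φ x (birkhoffSum T ρ n x + s) =
          ∫ s in birkhoffSum T ρ n x..(birkhoffSum T ρ n x + ρ (T^[n] x)), Φ x s := by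
        rw [intervalIntegral.integral_comp_add_left (Φ x), add_zero]
      rw [← this]
      refine intervalIntegral.integral_congr fun s hs => ?_
      rw [uIcc_of_le (hρ.nonneg _)] at hs
      exact jump_iterate hρ.nonneg hx n s hs.1
  refine tendsto_mean_of_tendsto_subsequence (a := fun n => birkhoffSum T ρ n x) (R := R) (C := C)
    (F := fun t => ∫ s in (0 : ℝ)..t, Φ x s) hρ.pos (birkhoffSum_zero T ρ x) (fun n => ?_)
    (fun n => ?_) (fun s t _ hst => ?_) ?_
  · rw [birkhoffSum_succ, add_sub_cancel_left]; exact hρ.lower _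
  · rw [birkhoffSum_succ, add_sub_cancel_left]; exact hρ.upper _
  · rw [intervalIntegral.integral_interval_sub_left (hi _ _) (hi _ _)]
    refine (abs_integral_section_le hΦ.bound x s t).trans ?_
    rw [abs_of_nonneg (sub_nonneg.2 hst)]
  · have h3 := h1.div h2 hρ.integral_pos.ne'
    rw [← div_eq_inv_mul]
    refine h3.congr' ?_
    filter_upwards [eventually_gt_atTop 0] with n hn
    have hn0 : (n : ℝ) ≠ 0 := by exact_mod_cast hn.ne'
    simp only [Pi.div_apply, hsum]
    rw [div_div_div_cancel_right₀ hn0]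

/-- An orbital function that is almost surely constant along orbits, for each fixed time lag, is
almost surely constant. -/
theorem IsOrbital.ae_const [IsProbabilityMeasure m] (hT : Ergodic T m)
    (hρ : IsRoof ρ c R) (hΦ : IsOrbital m T ρ Φ C)
    (hinv : ∀ t, 0 ≤ t → ∀ᵐ z ∂(m.prod (volume : Measure ℝ)), 0 ≤ z.2 → z.2 < ρ z.1 →
      Φ z.1 (z.2 + t) = Φ z.1 z.2) :
    ∃ κ, ∀ᵐ z ∂(m.prod (volume : Measure ℝ)), 0 ≤ z.2 → Φ z.1 z.2 = κ := by
  have hm1 : Measurable fun p : (X × ℝ) × ℝ => Φ p.1.1 (p.1.2 + p.2) :=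
    hΦ.measurable.comp ((measurable_fst.comp measurable_fst).prodMk
      ((measurable_snd.comp measurable_fst).add measurable_snd))
  have hm2 : Measurable fun p : (X × ℝ) × ℝ => Φ p.1.1 p.1.2 := hΦ.measurable.comp measurable_fst
  have hset : MeasurableSet {p : (X × ℝ) × ℝ | 0 ≤ p.2 → 0 ≤ p.1.2 → p.1.2 < ρ p.1.1 →
      Φ p.1.1 (p.1.2 + p.2) = Φ p.1.1 p.1.2} := by
    refine MeasurableSet.imp (measurableSet_le measurable_const measurable_snd)
      (MeasurableSet.imp (measurableSet_le measurable_const (measurable_snd.comp measurable_fst))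
      (MeasurableSet.imp (measurableSet_lt (measurable_snd.comp measurable_fst)
        (hρ.measurable.comp (measurable_fst.comp measurable_fst))) (measurableSet_eq_fun hm1 hm2)))
  -- Fubini turns a null set for each lag `t` into one null set of positions, outside of which
  -- almost every lag is good.
  have h1 : ∀ᵐ z ∂(m.prod (volume : Measure ℝ)), ∀ᵐ t ∂(volume : Measure ℝ),
      0 ≤ t → 0 ≤ z.2 → z.2 < ρ z.1 → Φ z.1 (z.2 + t) = Φ z.1 z.2 := by
    rw [Measure.ae_ae_comm hset]
    refine Eventually.of_forall fun t => ?_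
    by_cases ht : 0 ≤ t
    · filter_upwards [hinv t ht] with z hz _ using hz
    · exact Eventually.of_forall fun z h => absurd h ht
  have h2 := Measure.ae_ae_of_ae_prod h1
  have hconst : ∀ᵐ x ∂m, ∀ᵐ s ∂(volume : Measure ℝ), 0 ≤ s →
      Φ x s = ∫ w in (0 : ℝ)..1, Φ x w := by
    filter_upwards [h2] with x hx
    have hcpos : 0 < ρ x := hρ.pos.trans_le (hρ.lower x)
    have hae : ∀ s, (∀ᵐ t ∂(volume : Measure ℝ), 0 ≤ t → 0 ≤ s → s < ρ x →
        Φ x (s + t) = Φ x s) → 0 ≤ s → s < ρ x →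
        ∀ᵐ w ∂(volume : Measure ℝ), s ≤ w → Φ x w = Φ x s := fun s hs h0 h1 => by
      have := (measurePreserving_add_left (volume : Measure ℝ) (-s)).quasiMeasurePreserving.ae hs
      filter_upwards [this] with w hw hsw
      have := hw (by linarith) h0 h1
      rwa [add_neg_cancel_left] at this
    obtain ⟨s₀, hs₀, hg₀⟩ : ∃ s ∈ Ico 0 (ρ x), ∀ᵐ t ∂(volume : Measure ℝ), 0 ≤ t → 0 ≤ s →
        s < ρ x → Φ x (s + t) = Φ x s := by
      by_contra hcon
      have hnull : (volume : Measure ℝ) (Ico 0 (ρ x)) = 0 :=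
        measure_mono_null (fun s hs h => hcon ⟨s, hs, h⟩) (ae_iff.1 hx)
      simp at hnull
      exact absurd hcpos (not_lt.2 hnull)
    have hk : ∀ᵐ w ∂(volume : Measure ℝ), 0 ≤ w → Φ x w = Φ x s₀ := by
      filter_upwards [hx, hae s₀ hg₀ hs₀.1 hs₀.2] with w hw hw' h0
      rcases le_or_gt s₀ w with h | h
      · exact hw' h
      · have hA := hae w hw h0 (h.trans hs₀.2)
        -- A height `w` below `s₀` is compared with `s₀` through a common later time `y`.
        obtain ⟨y, hy, h3, h4⟩ : ∃ y ∈ Ici s₀, (w ≤ y → Φ x y = Φ x w) ∧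
            (s₀ ≤ y → Φ x y = Φ x s₀) := by
          by_contra! hcon
          have hnull : (volume : Measure ℝ) (Ici s₀) = 0 := by
            refine measure_mono_null (fun y hy => ?_)
              (ae_iff.1 (hA.and (hae s₀ hg₀ hs₀.1 hs₀.2)))
            rintro ⟨h3, h4⟩
            obtain ⟨h5, h6⟩ := hcon y hy h3
            exact h6 (h4 h5)
          simp at hnull
        have hy : s₀ ≤ y := hy
        rw [← h3 (h.le.trans hy), h4 hy]
    have hval : ∫ w in (0 : ℝ)..1, Φ x w = Φ x s₀ := by
      rw [intervalIntegral.integral_congr_ae (g := fun _ => Φ x s₀)]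
      · simp
      · filter_upwards [hk] with w hw hmem
        rw [uIoc_of_le zero_le_one] at hmem
        exact hw hmem.1.le
    rw [hval]
    exact hk
  have hTc := hT.toMeasurePreserving
  -- The average over a unit time interval is a measurable expression for the constant along the
  -- orbit; by the jump relation it is invariant under `T`.
  set g : X → ℝ := fun x => ∫ w in (0 : ℝ)..1, Φ x w with hg
  have hgm : Measurable g :=
    measurable_integral_section hΦ.measurable measurable_const fun _ => zero_le_one
  obtain ⟨κ, hκ⟩ := hT.ae_eq_const_of_ae_eq_comp_ae hgm.aestronglyMeasurable (by
    filter_upwards [hΦ.jump, hconst] with x hx hc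
    have e1 : g (T x) = ∫ w in (0 : ℝ)..1, Φ x (ρ x + w) := by
      refine intervalIntegral.integral_congr fun s hs => ?_
      rw [uIcc_of_le zero_le_one] at hs
      exact (hx s hs.1).symm
    have e2 : ∫ w in (0 : ℝ)..1, Φ x (ρ x + w) = ∫ w in (0 : ℝ)..1, g x := by
      refine intervalIntegral.integral_congr_ae ?_
      have := (measurePreserving_add_left (volume : Measure ℝ) (ρ x)).quasiMeasurePreserving.ae hc
      filter_upwards [this] with w hw hmem
      rw [uIoc_of_le zero_le_one] at hmem
      exact hw (add_nonneg (hρ.nonneg x) hmem.1.le)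
    rw [Function.comp_apply, e1, e2]
    simp)
  refine ⟨κ, ?_⟩
  have hset2 : MeasurableSet {z : X × ℝ | 0 ≤ z.2 → Φ z.1 z.2 = κ} :=
    MeasurableSet.imp (measurableSet_le measurable_const measurable_snd)
      (measurableSet_eq_fun hΦ.measurable measurable_const)
  rw [Measure.ae_prod_iff_ae_ae hset2]
  filter_upwards [hconst, hκ] with x hx hk
  filter_upwards [hx] with s hs h0
  rw [hs h0]
  exact hk

/-! ### The suspension measure -/

theorem measurableSet_region (hρ : IsRoof ρ c R) :
    MeasurableSet {z : X × ℝ | 0 ≤ z.2 ∧ z.2 < ρ z.1} :=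
  (measurableSet_le measurable_const measurable_snd).inter
    (measurableSet_lt measurable_snd (hρ.measurable.comp measurable_fst))

theorem prod_region_lt_top [IsProbabilityMeasure m] (hρ : IsRoof ρ c R) :
    (m.prod (volume : Measure ℝ)) {z : X × ℝ | 0 ≤ z.2 ∧ z.2 < ρ z.1} < ⊤ := by
  refine lt_of_le_of_lt (measure_mono (t := univ ×ˢ Ico 0 R) fun z hz =>
    ⟨mem_univ _, hz.1, hz.2.trans_le (hρ.upper _)⟩) ?_
  rw [Measure.prod_prod]
  simp

theorem integral_measure [IsProbabilityMeasure m] (hρ : IsRoof ρ c R)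
    (hΦ : Measurable (Function.uncurry Φ)) (hC : ∀ x s, |Φ x s| ≤ C) :
    ∫ z, Φ z.1 z.2 ∂(measure m ρ) =
      (∫ x, ρ x ∂m)⁻¹ * ∫ x, (∫ s in (0 : ℝ)..ρ x, Φ x s) ∂m := by
  have hreg := measurableSet_region hρ
  rw [measure, integral_smul_measure, ENNReal.toReal_inv,
    ENNReal.toReal_ofReal hρ.integral_pos.le, smul_eq_mul]
  congr 1
  have hint : IntegrableOn (fun z : X × ℝ => Φ z.1 z.2)
      {z : X × ℝ | 0 ≤ z.2 ∧ z.2 < ρ z.1} (m.prod volume) := by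
    have : IsFiniteMeasure ((m.prod (volume : Measure ℝ)).restrict
      {z : X × ℝ | 0 ≤ z.2 ∧ z.2 < ρ z.1}) := ⟨by
        rw [Measure.restrict_apply_univ]; exact prod_region_lt_top hρ⟩
    exact Integrable.of_bound hΦ.aestronglyMeasurable C (Eventually.of_forall fun z => hC _ _)
  rw [← integral_indicator hreg, integral_prod _ ((integrable_indicator_iff hreg).2 hint)]
  refine integral_congr_ae (Eventually.of_forall fun x => ?_)
  dsimp only
  rw [intervalIntegral.integral_of_le (hρ.nonneg x), ← integral_Ico_eq_integral_Ioc,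
    ← integral_indicator measurableSet_Ico]
  rfl

theorem isProbabilityMeasure_measure [IsProbabilityMeasure m] (hρ : IsRoof ρ c R) :
    IsProbabilityMeasure (measure m ρ) := by
  have h := integral_measure (m := m) (Φ := fun _ _ => 1) (C := 1) hρ measurable_const
    fun _ _ => by simp
  have h1 : ∫ x, (∫ _s in (0 : ℝ)..ρ x, (1 : ℝ)) ∂m = ∫ x, ρ x ∂m := by simp
  rw [h1, inv_mul_cancel₀ hρ.integral_pos.ne'] at h
  refine ⟨?_⟩
  simp only [integral_const, smul_eq_mul, mul_one] at h
  rw [Measure.real, ENNReal.toReal_eq_one_iff] at h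
  exact h

theorem ae_measure_iff [IsProbabilityMeasure m] (hρ : IsRoof ρ c R) {p : X × ℝ → Prop} :
    (∀ᵐ z ∂(measure m ρ), p z) ↔
      ∀ᵐ z ∂(m.prod (volume : Measure ℝ)), 0 ≤ z.2 ∧ z.2 < ρ z.1 → p z := by
  have hc0 : (ENNReal.ofReal (∫ x, ρ x ∂m))⁻¹ ≠ 0 := ENNReal.inv_ne_zero.2 ENNReal.ofReal_ne_top
  rw [measure, Measure.ae_ennreal_smul_measure_iff hc0, ae_restrict_iff' (measurableSet_region hρ)]
  rfl

end

/-! ### Factors of suspension semiflows -/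

/-- `N x w` is the state at time `w ≥ 0` of the semiflow `S` when it starts over the base point
`x` of the suspension with roof `ρ` over `T`. -/
structure IsCover {Z : Type*} [MeasurableSpace Z] (m : Measure X) (T : X → X) (ρ : X → ℝ)
    (S : ℝ → Z → Z) (N : X → ℝ → Z) : Prop where
  measurable : Measurable (Function.uncurry N)
  measurable_flow : ∀ t, Measurable (S t)
  jump : ∀ᵐ x ∂m, ∀ w, 0 ≤ w → N x (ρ x + w) = N (T x) w
  semiflow : ∀ x s t, 0 ≤ s → 0 ≤ t → S t (N x s) = N x (s + t)

section

variable {m : Measure X} {T : X → X} {ρ : X → ℝ} {c R : ℝ}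
  {Z : Type*} [MeasurableSpace Z] {S : ℝ → Z → Z} {N : X → ℝ → Z}

theorem IsCover.isOrbital (hN : IsCover m T ρ S N) {f : Z → ℝ} {C : ℝ} (hf : Measurable f)
    (hC : ∀ z, |f z| ≤ C) : IsOrbital m T ρ (fun x w => f (N x w)) C where
  measurable := hf.comp hN.measurable
  bound x s := hC _
  jump := by
    filter_upwards [hN.jump] with x hx w hw
    rw [hx w hw]

variable [IsProbabilityMeasure m]

/-- `N x` is defined for all times, also beyond the roof, and there the semiflow merely adds times.
Undoing the passages through the roof one by one rewrites `N x (s + t)` as `N` at the position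
reached by the suspension semiflow. -/
theorem IsCover.ae_equivariant (hN : IsCover m T ρ S N) (hT : MeasurePreserving T m m)
    (hρ : IsRoof ρ c R) :
    ∀ᵐ z ∂(measure m ρ), ∀ t : ℝ, 0 ≤ t →
      Function.uncurry N (flow T ρ t z) = S t (Function.uncurry N z) := by
  rw [ae_measure_iff hρ]
  have := (Measure.quasiMeasurePreserving_fst (μ := m) (ν := (volume : Measure ℝ))).ae
    (ae_forall_iterate hT hN.jump)
  filter_upwards [this] with z hz hreg t ht
  have hst : 0 ≤ z.2 + t := add_nonneg hreg.1 ht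
  have hlow : ∀ n : ℕ, n * c ≤ birkhoffSum T ρ n z.1 := fun n => by
    induction n with
    | zero => simp
    | succ n ih =>
      rw [birkhoffSum_succ]
      have := hρ.lower (T^[n] z.1)
      push_cast
      linarith
  -- The supremum is attained: the set contains `0`, and it is bounded because the roof is at least
  -- `c`.
  have hmem : passages T ρ z.1 (z.2 + t) ∈ {n : ℕ | birkhoffSum T ρ n z.1 ≤ z.2 + t} := by
    refine Nat.sSup_mem ⟨0, by simpa using hst⟩ ?_
    obtain ⟨B, hB⟩ := exists_nat_ge ((z.2 + t) / c)
    refine ⟨B, fun n hn => ?_⟩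
    have h1 : (n : ℝ) * c ≤ z.2 + t := (hlow n).trans hn
    have h2 : (n : ℝ) ≤ (z.2 + t) / c := (le_div_iff₀ hρ.pos).2 h1
    exact_mod_cast h2.trans hB
  have hmem : birkhoffSum T ρ (passages T ρ z.1 (z.2 + t)) z.1 ≤ z.2 + t := hmem
  have hz1 : S t (Function.uncurry N z) = N z.1 (z.2 + t) := hN.semiflow _ _ _ hreg.1 ht
  rw [hz1, ← add_sub_cancel
    (birkhoffSum T ρ (passages T ρ z.1 (z.2 + t)) z.1) (z.2 + t),
    jump_iterate hρ.nonneg hz _ _ (sub_nonneg.2 hmem)]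
  rfl

/-- This is `IsOrbital.integral_translate` for the indicator of a set, read along `N`. -/
theorem IsCover.measurePreserving_flow (hN : IsCover m T ρ S N) (hT : MeasurePreserving T m m)
    (hρ : IsRoof ρ c R) {t : ℝ} (ht : 0 ≤ t) :
    MeasurePreserving (S t) ((measure m ρ).map (Function.uncurry N))
      ((measure m ρ).map (Function.uncurry N)) := by
  have hprob := isProbabilityMeasure_measure (m := m) hρ
  refine ⟨hN.measurable_flow t, ?_⟩
  ext A hA
  rw [Measure.map_apply (hN.measurable_flow t) hA,
    Measure.map_apply hN.measurable (hN.measurable_flow t hA), Measure.map_apply hN.measurable hA]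
  have hind : Measurable (A.indicator fun _ => (1 : ℝ)) := measurable_const.indicator hA
  have hb : ∀ z, |A.indicator (fun _ => (1 : ℝ)) z| ≤ 1 := fun z => by
    by_cases h : z ∈ A <;> simp [h]
  have hO := hN.isOrbital hind hb
  have hkey := hO.integral_translate hT hρ ht
  have e1 := integral_measure (m := m) hρ hO.measurable hO.bound
  have hm2 : Measurable (Function.uncurry fun x s => A.indicator (fun _ => (1 : ℝ)) (N x (s + t))) :=
    hO.measurable.comp (measurable_fst.prodMk (measurable_snd.add_const t))
  have e2 := integral_measure (m := m) hρ hm2 fun x s => hb _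
  rw [hkey, ← e1] at e2
  have i1 : ∫ z, A.indicator (fun _ => (1 : ℝ)) (N z.1 z.2) ∂(measure m ρ) =
      (measure m ρ).real (Function.uncurry N ⁻¹' A) := by
    rw [← integral_indicator_one (hN.measurable hA)]
    rfl
  have i2 : ∫ z, A.indicator (fun _ => (1 : ℝ)) (N z.1 (z.2 + t)) ∂(measure m ρ) =
      (measure m ρ).real (Function.uncurry N ⁻¹' (S t ⁻¹' A)) := by
    rw [← integral_indicator_one (hN.measurable (hN.measurable_flow t hA))]
    refine integral_congr_ae ((ae_measure_iff hρ).2 (Eventually.of_forall fun z hz => ?_))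
    have hiff : z ∈ Function.uncurry N ⁻¹' (S t ⁻¹' A) ↔ N z.1 (z.2 + t) ∈ A := by
      rw [← hN.semiflow _ _ _ hz.1 ht]
      rfl
    dsimp only
    by_cases h : N z.1 (z.2 + t) ∈ A
    · rw [indicator_of_mem h, indicator_of_mem (hiff.2 h), Pi.one_apply]
    · rw [indicator_of_notMem h, indicator_of_notMem fun h' => h (hiff.1 h')]
  rw [i1, i2] at e2
  exact (measureReal_eq_measureReal_iff (measure_ne_top _ _) (measure_ne_top _ _)).1 e2

/-- The indicator of the set, read along `N`, is constant along orbits for each fixed lag, so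
`IsOrbital.ae_const` applies. -/
theorem IsCover.ergodic (hN : IsCover m T ρ S N) (hT : Ergodic T m)
    (hρ : IsRoof ρ c R) {A : Set Z} (hA : MeasurableSet A)
    (hinv : ∀ t : ℝ, 0 ≤ t → S t ⁻¹' A =ᵐ[(measure m ρ).map (Function.uncurry N)] A) :
    (measure m ρ).map (Function.uncurry N) A = 0 ∨
      (measure m ρ).map (Function.uncurry N) Aᶜ = 0 := by
  have hind : Measurable (A.indicator fun _ => (1 : ℝ)) := measurable_const.indicator hA
  have hb : ∀ z, |A.indicator (fun _ => (1 : ℝ)) z| ≤ 1 := fun z => by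
    by_cases h : z ∈ A <;> simp [h]
  obtain ⟨κ, hκ⟩ := (hN.isOrbital hind hb).ae_const hT hρ fun t ht => by
    have h1 := (ae_measure_iff hρ).1 (ae_of_ae_map hN.measurable.aemeasurable (hinv t ht))
    filter_upwards [h1] with z hz h0 hlt
    have : S t (N z.1 z.2) ∈ A ↔ N z.1 z.2 ∈ A := iff_of_eq (hz ⟨h0, hlt⟩)
    rw [hN.semiflow _ _ _ h0 ht] at this
    by_cases h : N z.1 z.2 ∈ A
    · rw [indicator_of_mem h, indicator_of_mem (this.2 h)]
    · rw [indicator_of_notMem h, indicator_of_notMem fun h' => h (this.1 h')]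
  have hae : ∀ᵐ z ∂(measure m ρ), A.indicator (fun _ => (1 : ℝ)) (N z.1 z.2) = κ :=
    (ae_measure_iff hρ).2 (by filter_upwards [hκ] with z hz h using hz h.1)
  rw [Measure.map_apply hN.measurable hA, Measure.map_apply hN.measurable hA.compl]
  by_cases h0 : κ = 0
  · left
    refine measure_mono_null (fun z hz => ?_) (ae_iff.1 hae)
    have hz : N z.1 z.2 ∈ A := hz
    simp [hz, h0]
  · right
    refine measure_mono_null (fun z hz => ?_) (ae_iff.1 hae)
    have hz : N z.1 z.2 ∉ A := hz
    simp only [mem_ofPred_eq, indicator_of_notMem hz]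
    exact fun h => h0 h.symm

theorem IsCover.ae_tendsto_mean (hN : IsCover m T ρ S N) (hT : Ergodic T m)
    (hρ : IsRoof ρ c R) {f : Z → ℝ} {C : ℝ} (hf : Measurable f) (hC : ∀ z, |f z| ≤ C) :
    ∀ᵐ x ∂m, Tendsto (fun t : ℝ => t⁻¹ * ∫ s in (0 : ℝ)..t, f (N x s)) atTop
      (𝓝 (∫ z, f z ∂((measure m ρ).map (Function.uncurry N)))) := by
  have hO := hN.isOrbital hf hC
  have := hO.ae_tendsto_mean hT hρ
  rw [← integral_measure hρ hO.measurable hO.bound] at this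
  rw [integral_map hN.measurable.aemeasurable hf.aestronglyMeasurable]
  exact this

end

end Suspension

namespace Model

variable {I : Type*} [Fintype I] [MeasurableSpace I] (M : Model I)

/-! ### The coding map -/

/-- The bound is uniform in `ω` as well as in the word, which gives continuity of the coding jointly
in both. -/
theorem exists_summable_bound : ∃ g : ℕ → ℝ, Summable g ∧ ∀ (ω : ℕ → I) (u : M.Words ω) (n : ℕ),
    ‖(∏ j ∈ Finset.range n, M.r (ω j)) * M.t (ω n) (u n)‖ ≤ g n := by
  cases isEmpty_or_nonempty I with
  | inl h => exact ⟨0, summable_zero, fun ω => (h.false (ω 0)).elim⟩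
  | inr h =>
    obtain ⟨i₀, -, hi₀⟩ := Finset.exists_max_image Finset.univ (fun i => |M.r i|)
      Finset.univ_nonempty
    refine ⟨fun n => |M.r i₀| ^ n * ∑ i, ∑ j, |M.t i j|,
      (summable_geometric_of_lt_one (abs_nonneg _) (M.abs_r_lt_one i₀)).mul_right _,
      fun ω u n => ?_⟩
    rw [norm_mul, Real.norm_eq_abs, Real.norm_eq_abs, Finset.abs_prod]
    refine mul_le_mul ?_ ?_ (abs_nonneg _) (by positivity)
    · calc ∏ j ∈ Finset.range n, |M.r (ω j)| ≤ ∏ _j ∈ Finset.range n, |M.r i₀| :=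
            Finset.prod_le_prod (fun _ _ => abs_nonneg _) fun j _ => hi₀ _ (Finset.mem_univ _)
        _ = |M.r i₀| ^ n := by simp
    · calc |M.t (ω n) (u n)| ≤ ∑ j, |M.t (ω n) j| :=
            Finset.single_le_sum (f := fun j => |M.t (ω n) j|)
              (fun _ _ => abs_nonneg _) (Finset.mem_univ _)
        _ ≤ ∑ i, ∑ j, |M.t i j| :=
            Finset.single_le_sum (f := fun i => ∑ j, |M.t i j|)
              (fun _ _ => Finset.sum_nonneg fun _ _ => abs_nonneg _) (Finset.mem_univ _)

/-- The tail of a word. -/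
def tail {ω : ℕ → I} (u : M.Words ω) : M.Words (Suspension.shift ω) := fun n => u (n + 1)

theorem coding_eq (ω : ℕ → I) (u : M.Words ω) :
    M.coding ω u = M.f (ω 0) (u 0) (M.coding (Suspension.shift ω) (M.tail u)) := by
  rw [coding, (M.summable_coding ω u).tsum_eq_zero_add, f, coding, ← tsum_mul_left, add_comm]
  simp only [Finset.range_zero, Finset.prod_empty, one_mul]
  congr 1
  refine tsum_congr fun n => ?_
  rw [Finset.prod_range_succ', mul_comm _ (M.r (ω 0)), mul_assoc]
  rfl

theorem continuous_coding (ω : ℕ → I) : Continuous (M.coding ω) := by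
  obtain ⟨g, hg, hb⟩ := M.exists_summable_bound
  exact continuous_tsum
    (fun n => continuous_const.mul (continuous_of_discreteTopology.comp (continuous_apply n))) hg
    fun n u => hb ω u n

theorem letterMeasure_singleton (i : I) (j : Fin (M.k i)) :
    M.letterMeasure i {j} = ENNReal.ofReal (M.p i j) := by
  classical
  rw [letterMeasure, Measure.coe_finsetSum, Finset.sum_apply, Finset.sum_eq_single j]
  · simp
  · intro b _ hb
    simp [hb]
  · simp

theorem letterMeasure_pos {i : I} {j : Fin (M.k i)} {s : Set (Fin (M.k i))} (h : j ∈ s) :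
    0 < M.letterMeasure i s :=
  lt_of_lt_of_le (by rw [letterMeasure_singleton]; exact ENNReal.ofReal_pos.2 (M.p_pos i j))
    (measure_mono (singleton_subset_iff.2 h))

/-- Coding is continuous and every cylinder has positive mass, since the weights `p` are strictly
positive. The conclusion thus holds for every word, not just almost every one. -/
theorem coding_mem_support (ω : ℕ → I) (u : M.Words ω) :
    M.coding ω u ∈ (M.eta ω).support := by
  rw [Measure.mem_support_iff_forall]
  intro U hU
  have hpre : M.coding ω ⁻¹' U ∈ 𝓝 u := (M.continuous_coding ω).continuousAt hU
  rw [nhds_pi, Filter.mem_pi'] at hpre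
  obtain ⟨s, t, ht, hst⟩ := hpre
  refine lt_of_lt_of_le ?_ (Measure.le_map_apply (M.measurable_coding ω).aemeasurable U)
  refine lt_of_lt_of_le ?_ (measure_mono hst)
  rw [wordMeasure, Measure.infinitePi_pi _ fun i _ => MeasurableSet.of_discrete]
  exact pos_iff_ne_zero.2 (Finset.prod_ne_zero_iff.2 fun i _ =>
    (M.letterMeasure_pos (mem_of_mem_nhds (ht i))).ne')

/-- The self-similarity of the measures `η^(ω)`, seen near a point of a separated piece. -/
theorem pullback_eta {τ : ℝ} (hτ : M.SeparatedAtScale τ) (ω : ℕ → I) (u : M.Words ω) {b : ℝ}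
    (hb0 : b ≠ 0) (hb : |b| ≤ Real.exp (-τ)) :
    Scenery.pullback (M.eta ω) (M.coding ω u) (M.r (ω 0) * b) =
      ENNReal.ofReal (M.p (ω 0) (u 0)) • Scenery.pullback (M.eta (Suspension.shift ω))
        (M.coding (Suspension.shift ω) (M.tail u)) b := by
  have hr0 := M.r_ne_zero (ω 0)
  have hrb : M.r (ω 0) * b ≠ 0 := mul_ne_zero hr0 hb0
  refine Measure.ext fun E hE => ?_
  have hm : ∀ x a : ℝ, MeasurableSet {z : ℝ | (z - x) / a ∈ Subtype.val '' E} := fun x a =>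
    ((measurable_id.sub_const x).div_const a)
      ((MeasurableEmbedding.subtype_coe measurableSet_Icc).measurableSet_image.2 hE)
  rw [Measure.smul_apply, Scenery.pullback_apply _ _ hrb, Scenery.pullback_apply _ _ hb0, eta, eta,
    Measure.map_apply (M.measurable_coding _) (hm _ _),
    Measure.map_apply (M.measurable_coding _) (hm _ _), wordMeasure,
    ← map_natCons_prod_infinitePi, Measure.map_apply measurable_natCons
      (M.measurable_coding _ (hm _ _)), ← letterMeasure_singleton, smul_eq_mul]
  have hset : (fun z : Fin (M.k (ω 0)) × (∀ n, Fin (M.k (ω (n + 1)))) =>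
      natCons (X := fun n => Fin (M.k (ω n))) z.1 z.2) ⁻¹' (M.coding ω ⁻¹'
        {z : ℝ | (z - M.coding ω u) / (M.r (ω 0) * b) ∈ Subtype.val '' E}) =
      {u 0} ×ˢ (M.coding (Suspension.shift ω) ⁻¹'
        {z : ℝ | (z - M.coding (Suspension.shift ω) (M.tail u)) / b ∈ Subtype.val '' E}) := by
    ext ⟨j, w⟩
    have hcod : M.coding ω (natCons (X := fun n => Fin (M.k (ω n))) j w) =
        M.f (ω 0) j (M.coding (Suspension.shift ω) w) := M.coding_eq ω _
    simp only [mem_preimage, hcod, mem_ofPred_eq]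
    -- A point seen in the window is within `|r b| < |b| ≤ e^{-τ}` of the centre, hence lies in the
    -- same first-level piece.
    have hcase : ((M.f (ω 0) j (M.coding (Suspension.shift ω) w) - M.coding ω u) /
        (M.r (ω 0) * b) ∈ Subtype.val '' E) → j = u 0 := by
      rintro ⟨e, -, he⟩
      by_contra hj
      have hsep := hτ ω j (u 0) hj _ ⟨_, ⟨w, rfl⟩, rfl⟩ _ ⟨_, ⟨M.tail u, rfl⟩, rfl⟩
      rw [← M.coding_eq ω u] at hsep
      rw [eq_div_iff hrb] at he
      rw [← he, abs_mul, abs_mul] at hsep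
      have h1 : |(e : ℝ)| ≤ 1 := abs_le.2 e.2
      have h2 := M.abs_r_lt_one (ω 0)
      have h3 : 0 < |b| := abs_pos.2 hb0
      have h4 : |M.r (ω 0)| * |b| < |b| := by nlinarith
      have h5 : |(e : ℝ)| * (|M.r (ω 0)| * |b|) ≤ 1 * (|M.r (ω 0)| * |b|) :=
        mul_le_mul_of_nonneg_right h1 (by positivity)
      linarith
    have heq : (M.f (ω 0) (u 0) (M.coding (Suspension.shift ω) w) - M.coding ω u) /
        (M.r (ω 0) * b) =
        (M.coding (Suspension.shift ω) w - M.coding (Suspension.shift ω) (M.tail u)) / b := by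
      rw [M.coding_eq ω u, f, f, add_sub_add_right_eq_sub, ← mul_sub, mul_div_mul_left _ _ hr0]
    constructor
    · intro h
      have hj := hcase h
      subst hj
      rw [heq] at h
      exact ⟨rfl, h⟩
    · rintro ⟨hj, h⟩
      subst hj
      rw [heq]
      exact h
  rw [hset]
  exact Measure.prod_prod _ _

/-! ### Sequences of symbols -/

instance : DiscreteMeasurableSpace M.Symbols := ⟨fun s =>
  MeasurableSpace.measurableSet_iInf.2 fun i =>
    (MeasurableSet.of_discrete : MeasurableSet (Sigma.mk i ⁻¹' s))⟩

/-- The point `Π_ω (u)` coded by a sequence of symbols `(ω_n, u_n)`. -/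
def point (x : ℕ → M.Symbols) : ℝ := M.coding (fun n => (x n).1) fun n => (x n).2

/-- The measure `η^(ω)` determined by a sequence of symbols `(ω_n, u_n)`. -/
abbrev symbolEta (x : ℕ → M.Symbols) : Measure ℝ := M.eta fun n => (x n).1

theorem point_mem_support (x : ℕ → M.Symbols) : M.point x ∈ (M.symbolEta x).support :=
  M.coding_mem_support _ _

/-- The blow-up of `η^(ω)` at `Π_ω (u)` by the (signed) factor `1 / b`. -/
def blowUpAt (x : ℕ → M.Symbols) (b : ℝ) : ProbabilityMeasure Scenery.Window :=
  Scenery.blowUp (M.symbolEta x) (M.point x) b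

/-- The mass of the first-level piece disappears in the normalization. The factor `b` is signed, so
a negative contraction ratio shows up as a reflection. -/
theorem blowUpAt_shift {τ : ℝ} (hτ : M.SeparatedAtScale τ) (x : ℕ → M.Symbols) {b : ℝ}
    (hb0 : b ≠ 0) (hb : |b| ≤ Real.exp (-τ)) :
    M.blowUpAt x (M.r (x 0).1 * b) = M.blowUpAt (Suspension.shift x) b :=
  Scenery.blowUp_eq_of_pullback (ENNReal.ofReal_pos.2 (M.p_pos _ _)).ne' ENNReal.ofReal_ne_top
    (M.pullback_eta hτ (fun n => (x n).1) (fun n => (x n).2) hb0 hb)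

theorem scale_blowUpAt (x : ℕ → M.Symbols) {b t : ℝ} (hb : b ≠ 0) (ht : 0 ≤ t) :
    Scenery.scale t (M.blowUpAt x b) = M.blowUpAt x (b * Real.exp (-t)) :=
  Scenery.scale_blowUp (M.point_mem_support x) hb ht

theorem etaAt_eq (x : ℕ → M.Symbols) : M.etaAt x = M.blowUpAt x 1 := rfl

theorem reflect_etaAt_eq (x : ℕ → M.Symbols) : Scenery.reflect (M.etaAt x) = M.blowUpAt x (-1) := by
  rw [etaAt_eq, blowUpAt, Scenery.reflect_blowUp (M.point_mem_support x) one_ne_zero, one_mul]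
  rfl

/-- This transports the second sequence to a word over the same `ω`, so that the dependent types
match. -/
theorem exists_eq_of_fst_eq {x y : ℕ → M.Symbols} (h : ∀ n, (x n).1 = (y n).1) :
    ∃ v : M.Words fun n => (x n).1, y = fun n => ⟨(x n).1, v n⟩ := by
  have : ∀ n, ∃ v : Fin (M.k (x n).1), y n = ⟨(x n).1, v⟩ := fun n => by
    have hn := h n
    rcases hy : y n with ⟨i, v⟩
    rw [hy] at hn
    dsimp only at hn
    subst hn
    exact ⟨v, rfl⟩
  choose v hv using this
  exact ⟨v, funext hv⟩

/-! ### Strong separation -/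

theorem StrongSeparation.head_eq {M : Model I} (h : M.StrongSeparation) {ω : ℕ → I}
    {u v : M.Words ω} (huv : M.coding ω u = M.coding ω v) : u 0 = v 0 := by
  by_contra hne
  refine Set.disjoint_left.1 (h ω hne) ⟨_, ⟨M.tail u, rfl⟩, rfl⟩ ?_
  rw [← M.coding_eq ω u, huv, M.coding_eq ω v]
  exact ⟨_, ⟨M.tail v, rfl⟩, rfl⟩

theorem StrongSeparation.coding_injective {M : Model I} (h : M.StrongSeparation) (ω : ℕ → I) :
    Function.Injective (M.coding ω) := by
  have key : ∀ (n : ℕ) (ω : ℕ → I) (u v : M.Words ω), M.coding ω u = M.coding ω v → u n = v n := by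
    intro n
    induction n with
    | zero => exact fun ω u v huv => h.head_eq huv
    | succ n ih =>
      intro ω u v huv
      refine ih (Suspension.shift ω) (M.tail u) (M.tail v) ?_
      have h0 := h.head_eq huv
      rw [M.coding_eq ω u, M.coding_eq ω v, f, f, h0] at huv
      exact mul_left_cancel₀ (M.r_ne_zero (ω 0)) (add_right_cancel huv)
  exact fun u v huv => funext fun n => key n ω u v huv

theorem StrongSeparation.measurableEmbedding_coding {M : Model I} (h : M.StrongSeparation)
    (ω : ℕ → I) : MeasurableEmbedding (M.coding ω) :=
  (M.measurable_coding ω).measurableEmbedding (h.coding_injective ω)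

/-- Compactness: pairs of symbol sequences over a common `ω` with different first letters form a
compact set, and the distance of their coded points is continuous and, by separation, positive. Its
minimum gives `τ`. -/
theorem StrongSeparation.exists_separatedAtScale {M : Model I} (h : M.StrongSeparation) :
    ∃ τ : ℝ, 0 ≤ τ ∧ M.SeparatedAtScale τ := by
  let _ : TopologicalSpace M.Symbols := ⊥
  have : DiscreteTopology M.Symbols := ⟨rfl⟩
  have hcont : Continuous M.point := by
    obtain ⟨g, hg, hb⟩ := M.exists_summable_bound
    refine continuous_tsum (fun n => Continuous.mul ?_ ?_) hg fun n x =>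
      hb (fun n => (x n).1) (fun n => (x n).2) n
    · exact continuous_finsetProd _ fun j _ =>
        (continuous_of_discreteTopology (f := fun s : M.Symbols => M.r s.1)).comp
          (continuous_apply j)
    · exact (continuous_of_discreteTopology (f := fun s : M.Symbols => M.t s.1 s.2)).comp
        (continuous_apply n)
  set K : Set ((ℕ → M.Symbols) × (ℕ → M.Symbols)) :=
    {z | (∀ n, (z.1 n).1 = (z.2 n).1) ∧ z.1 0 ≠ z.2 0} with hK
  have hKc : IsClosed K := by
    have hcl : ∀ (n : ℕ) (s : Set (M.Symbols × M.Symbols)),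
        IsClosed {z : (ℕ → M.Symbols) × (ℕ → M.Symbols) | (z.1 n, z.2 n) ∈ s} := fun n s =>
      (isClosed_discrete s).preimage (((continuous_apply n).comp continuous_fst).prodMk
        ((continuous_apply n).comp continuous_snd))
    have : K = (⋂ n, {z | (z.1 n, z.2 n) ∈ {s : M.Symbols × M.Symbols | s.1.1 = s.2.1}}) ∩
        {z | (z.1 0, z.2 0) ∈ {s : M.Symbols × M.Symbols | s.1 ≠ s.2}} := by
      ext z
      simp [hK]
    rw [this]
    exact (isClosed_iInter fun n => hcl n _).inter (hcl 0 _)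
  have hpair : ∀ (ω : ℕ → I) (u v : Fin (M.k (ω 0))), u ≠ v →
      ∀ y ∈ M.f (ω 0) u '' M.Y (Suspension.shift ω), ∀ z ∈ M.f (ω 0) v '' M.Y (Suspension.shift ω),
      ∃ p ∈ K, M.point p.1 = y ∧ M.point p.2 = z := by
    rintro ω u v huv - ⟨-, ⟨w, rfl⟩, rfl⟩ - ⟨-, ⟨w', rfl⟩, rfl⟩
    refine ⟨(fun n => ⟨ω n, natCons (X := fun n => Fin (M.k (ω n))) u w n⟩,
      fun n => ⟨ω n, natCons (X := fun n => Fin (M.k (ω n))) v w' n⟩), ⟨fun n => rfl, ?_⟩,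
      M.coding_eq ω _, M.coding_eq ω _⟩
    intro heq
    exact huv (eq_of_heq (Sigma.mk.inj heq).2)
  rcases K.eq_empty_or_nonempty with hE | hne
  -- No system has two maps, so there is nothing to separate.
  · refine ⟨0, le_rfl, fun ω u v huv y hy z hz => ?_⟩
    obtain ⟨p, hp, -⟩ := hpair ω u v huv y hy z hz
    rw [hE] at hp
    exact hp.elim
  · obtain ⟨p, hp, hmin⟩ := hKc.isCompact.exists_isMinOn hne
      (f := fun z => |M.point z.1 - M.point z.2|)
      (((hcont.comp continuous_fst).sub (hcont.comp continuous_snd)).abs.continuousOn)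
    have hpos : 0 < |M.point p.1 - M.point p.2| := by
      rw [abs_pos, sub_ne_zero]
      intro heq
      obtain ⟨v, hv⟩ := M.exists_eq_of_fst_eq hp.1
      rw [hv] at heq
      refine hp.2 ?_
      rw [hv]
      exact Sigma.ext rfl (heq_of_eq (h.head_eq (ω := fun n => (p.1 n).1)
        (u := fun n => (p.1 n).2) (v := v) heq))
    refine ⟨max 0 (-Real.log |M.point p.1 - M.point p.2|), le_max_left _ _,
      fun ω u v huv y hy z hz => ?_⟩
    obtain ⟨p', hp', rfl, rfl⟩ := hpair ω u v huv y hy z hz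
    refine le_trans ?_ (hmin hp')
    rw [← Real.le_log_iff_exp_le hpos]
    linarith [le_max_right 0 (-Real.log |M.point p.1 - M.point p.2|)]

end Model

namespace Model

variable {I : Type*} [Fintype I] [MeasurableSpace I] (M : Model I)

theorem measurable_point : Measurable M.point := by
  refine measurable_of_tendsto_metrizable
    (f := fun n x => ∑ l ∈ Finset.range n,
      (∏ j ∈ Finset.range l, M.r (x j).1) * M.t (x l).1 (x l).2) (fun n => ?_) ?_
  · refine Finset.measurable_sum _ fun l _ => Measurable.mul ?_ ?_
    · exact Finset.measurable_prod _ fun j _ =>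
        (Measurable.of_discrete (f := fun s : M.Symbols => M.r s.1)).comp (measurable_pi_apply j)
    · exact (Measurable.of_discrete (f := fun s : M.Symbols => M.t s.1 s.2)).comp
        (measurable_pi_apply l)
  · rw [tendsto_pi_nhds]
    exact fun x =>
      (M.summable_coding (fun n => (x n).1) (fun n => (x n).2)).hasSum.tendsto_sum_nat

/-! ### The law of a symbol -/

/-- The law of a single symbol. -/
def symbolMeasure : Measure M.Symbols :=
  ∑ s : M.Symbols, ENNReal.ofReal (M.symbolWeight s) • Measure.dirac s

theorem q_nonneg (i : I) : 0 ≤ M.q i := measureReal_nonneg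

theorem symbolWeight_nonneg (s : M.Symbols) : 0 ≤ M.symbolWeight s :=
  mul_nonneg (M.q_nonneg _) (M.p_pos _ _).le

theorem symbolMeasure_apply (t : Set M.Symbols) :
    M.symbolMeasure t =
      ∑ i, ENNReal.ofReal (M.q i) * M.letterMeasure i {u | (⟨i, u⟩ : M.Symbols) ∈ t} := by
  rw [symbolMeasure, Measure.coe_finsetSum, Finset.sum_apply, Fintype.sum_sigma]
  refine Finset.sum_congr rfl fun i _ => ?_
  rw [letterMeasure, Measure.coe_finsetSum, Finset.sum_apply, Finset.mul_sum]
  refine Finset.sum_congr rfl fun u _ => ?_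
  simp only [Measure.smul_apply, smul_eq_mul, Measure.dirac_apply' _ MeasurableSet.of_discrete]
  rw [symbolWeight, ENNReal.ofReal_mul (M.q_nonneg i), mul_assoc]
  rfl

theorem symbolMeasure_singleton (s : M.Symbols) :
    M.symbolMeasure {s} = ENNReal.ofReal (M.symbolWeight s) := by
  classical
  rw [symbolMeasure, Measure.coe_finsetSum, Finset.sum_apply, Finset.sum_eq_single s]
  · simp
  · intro b _ hb
    simp [hb]
  · simp

theorem bernoulliBase_eq : M.bernoulliBase = Measure.infinitePi fun _ : ℕ => M.symbolMeasure := rfl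

/-! ### Random tables of letters -/

/-- A letter for every element of `I`. -/
abbrev LetterTable : Type _ := ∀ i, Fin (M.k i)

/-- Independent tables of independent letters. -/
def tableMeasure : Measure (ℕ → M.LetterTable) :=
  Measure.infinitePi fun _ : ℕ => Measure.pi M.letterMeasure

instance : IsProbabilityMeasure M.tableMeasure := by unfold tableMeasure; infer_instance

/-- Read off a word from a sequence of tables. -/
def readTable (ω : ℕ → I) (z : ℕ → M.LetterTable) : M.Words ω := fun n => z n (ω n)

/-- The word space varies with `ω`; tables realize all the word measures on one probability space,
where measurability in `ω` and Fubini make sense. -/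
theorem measurePreserving_readTable (ω : ℕ → I) :
    MeasurePreserving (M.readTable ω) M.tableMeasure (M.wordMeasure ω) := by
  have hm : ∀ n, Measurable fun z : M.LetterTable => z (ω n) := fun n => measurable_pi_apply _
  refine ⟨measurable_pi_lambda _ fun n => (hm n).comp (measurable_pi_apply n), ?_⟩
  have := Measure.infinitePi_map_pi (fun _ : ℕ => Measure.pi M.letterMeasure) hm
  simp only [(measurePreserving_eval M.letterMeasure _).map_eq] at this
  exact this

theorem eta_apply (ω : ℕ → I) {E : Set ℝ} (hE : MeasurableSet E) :
    M.eta ω E = M.tableMeasure {z | M.coding ω (M.readTable ω z) ∈ E} := by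
  rw [eta, ← (M.measurePreserving_readTable ω).map_eq,
    Measure.map_map (M.measurable_coding ω) (M.measurePreserving_readTable ω).measurable,
    Measure.map_apply ((M.measurable_coding ω).comp (M.measurePreserving_readTable ω).measurable) hE]
  rfl

variable [MeasurableSingletonClass I]

theorem measurable_coding_readTable :
    Measurable fun p : (ℕ → I) × (ℕ → M.LetterTable) => M.coding p.1 (M.readTable p.1 p.2) := by
  refine measurable_of_tendsto_metrizable
    (f := fun n p => ∑ l ∈ Finset.range n,
      (∏ j ∈ Finset.range l, M.r (p.1 j)) * M.t (p.1 l) (p.2 l (p.1 l))) (fun n => ?_) ?_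
  · refine Finset.measurable_sum _ fun l _ => Measurable.mul ?_ ?_
    · exact Finset.measurable_prod _ fun j _ =>
        (measurable_of_finite M.r).comp ((measurable_pi_apply j).comp measurable_fst)
    · have hpair : Measurable fun p : (ℕ → I) × (ℕ → M.LetterTable) => (p.1 l, p.2 l) :=
        ((measurable_pi_apply l).comp measurable_fst).prodMk
          ((measurable_pi_apply l).comp measurable_snd)
      have ht : Measurable fun q : I × M.LetterTable => M.t q.1 (q.2 q.1) := measurable_of_finite _
      exact ht.comp hpair
  · rw [tendsto_pi_nhds]
    exact fun p => (M.summable_coding p.1 (M.readTable p.1 p.2)).hasSum.tendsto_sum_nat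

theorem measurable_eta : Measurable M.eta := by
  refine Measure.measurable_of_measurable_coe _ fun E hE => ?_
  simp_rw [M.eta_apply _ hE]
  exact measurable_measure_prodMk_left (M.measurable_coding_readTable hE)

theorem measurable_symbolEta : Measurable M.symbolEta :=
  M.measurable_eta.comp (measurable_pi_lambda _ fun n =>
    (Measurable.of_discrete (f := fun s : M.Symbols => s.1)).comp (measurable_pi_apply n))

theorem measurable_etaAt : Measurable M.etaAt :=
  Scenery.measurable_blowUp (ν := M.symbolEta) (x := M.point) (a := fun _ => 1)
    M.measurable_symbolEta M.measurable_point measurable_const fun _ => one_ne_zero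

/-! ### The Bernoulli base -/

variable {M}

theorem ofReal_q_eq {q : Measure I} [IsProbabilityMeasure q]
    (hP : M.P = Measure.infinitePi fun _ : ℕ => q) (i : I) :
    ENNReal.ofReal (M.q i) = q {i} := by
  have : IsProbabilityMeasure M.P := M.isProbabilityMeasure
  rw [Model.q, ofReal_measureReal, hP, ← Measure.infinitePi_map_eval (fun _ : ℕ => q) 0,
    Measure.map_apply (measurable_pi_apply 0) (measurableSet_singleton i)]
  rw [Measure.infinitePi_map_eval]
  rfl

theorem sum_ofReal_q {q : Measure I} [IsProbabilityMeasure q]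
    (hP : M.P = Measure.infinitePi fun _ : ℕ => q) : ∑ i, ENNReal.ofReal (M.q i) = 1 := by
  simp_rw [ofReal_q_eq hP]
  rw [sum_measure_singleton, Finset.coe_univ, measure_univ]

theorem IsBernoulli.isProbabilityMeasure_symbolMeasure (h : M.IsBernoulli) :
    IsProbabilityMeasure M.symbolMeasure := by
  obtain ⟨q, hq, hP⟩ := h
  refine ⟨?_⟩
  rw [symbolMeasure_apply]
  simpa using sum_ofReal_q hP

theorem IsBernoulli.sum_symbolWeight (h : M.IsBernoulli) : ∑ s, M.symbolWeight s = 1 := by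
  have := h.isProbabilityMeasure_symbolMeasure.measure_univ
  rw [symbolMeasure, Measure.coe_finsetSum, Finset.sum_apply] at this
  simp only [Measure.smul_apply, measure_univ, smul_eq_mul, mul_one] at this
  rw [← ENNReal.ofReal_sum_of_nonneg fun s _ => M.symbolWeight_nonneg s] at this
  exact ENNReal.ofReal_eq_one.1 this

variable (M) in
/-- Combine a sequence in `I` with a sequence of tables. -/
def joinTable (p : (ℕ → I) × (ℕ → M.LetterTable)) : ℕ → M.Symbols :=
  fun n => ⟨p.1 n, p.2 n (p.1 n)⟩

theorem measurable_joinTable : Measurable M.joinTable :=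
  measurable_pi_lambda _ fun n => by
    have hpair : Measurable fun p : (ℕ → I) × (ℕ → M.LetterTable) => (p.1 n, p.2 n) :=
      ((measurable_pi_apply n).comp measurable_fst).prodMk
        ((measurable_pi_apply n).comp measurable_snd)
    have ht : Measurable fun q : I × M.LetterTable => (⟨q.1, q.2 q.1⟩ : M.Symbols) :=
      measurable_of_finite _
    exact ht.comp hpair

/-- The Bernoulli base chooses `ω` by `P` and then a word for `ω`. -/
theorem IsBernoulli.measurePreserving_joinTable (h : M.IsBernoulli) :
    MeasurePreserving M.joinTable (M.P.prod M.tableMeasure) M.bernoulliBase := by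
  have hs := h.isProbabilityMeasure_symbolMeasure
  obtain ⟨q, hq, hP⟩ := h
  have hPp : IsProbabilityMeasure M.P := M.isProbabilityMeasure
  refine ⟨measurable_joinTable, ?_⟩
  rw [bernoulliBase_eq]
  refine Measure.eq_infinitePi _ fun s t ht => ?_
  have hpi : MeasurableSet ((s : Set ℕ).pi t) := MeasurableSet.pi s.countable_toSet fun i _ => ht i
  rw [Measure.map_apply measurable_joinTable hpi, Measure.prod_apply (measurable_joinTable hpi)]
  set g : ℕ → I → ENNReal :=
    fun n i => M.letterMeasure i {u | (⟨i, u⟩ : M.Symbols) ∈ t n} with hg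
  have h1 : ∀ ω : ℕ → I, M.tableMeasure (Prod.mk ω ⁻¹' (M.joinTable ⁻¹' (s : Set ℕ).pi t)) =
      ∏ n ∈ s, g n (ω n) := fun ω => by
    have : Prod.mk ω ⁻¹' (M.joinTable ⁻¹' (s : Set ℕ).pi t) = M.readTable ω ⁻¹'
        (s : Set ℕ).pi fun n => {u | (⟨ω n, u⟩ : M.Symbols) ∈ t n} := rfl
    rw [this, (M.measurePreserving_readTable ω).measure_preimage
      (MeasurableSet.pi s.countable_toSet fun i _ => MeasurableSet.of_discrete).nullMeasurableSet,
      wordMeasure, Measure.infinitePi_pi _ fun i _ => MeasurableSet.of_discrete]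
  simp_rw [h1]
  rw [hP]
  -- Under the product measure the expectation of `∏ g n (ω n)` factors, and each factor is the mass
  -- of `t n` under the law of one symbol.
  have hind := ProbabilityTheory.iIndepFun_infinitePi (P := fun _ : ℕ => q) (X := g)
    fun n => measurable_of_finite _
  rw [ProbabilityTheory.lintegral_prod_eq_prod_lintegral_of_indepFun s _ hind
    fun n => (measurable_of_finite (g n)).comp (measurable_pi_apply n)]
  refine Finset.prod_congr rfl fun n _ => ?_
  rw [symbolMeasure_apply]
  have := lintegral_map (measurable_of_finite (g n)) (measurable_pi_apply n)
    (μ := Measure.infinitePi fun _ : ℕ => q)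
  rw [Measure.infinitePi_map_eval] at this
  rw [← this, lintegral_fintype]
  exact Finset.sum_congr rfl fun i _ => by rw [ofReal_q_eq hP, mul_comm]

/-- What holds for almost every sequence of symbols holds for almost every `ω` and almost every
word for `ω`. -/
theorem IsBernoulli.ae_ae_wordMeasure (h : M.IsBernoulli) {G : (ℕ → M.Symbols) → Prop}
    (hG : ∀ᵐ x ∂M.bernoulliBase, G x) :
    ∀ᵐ ω ∂M.P, ∀ᵐ u ∂(M.wordMeasure ω), G fun n => ⟨ω n, u n⟩ := by
  have hPp : IsProbabilityMeasure M.P := M.isProbabilityMeasure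
  -- `G` need not be measurable, so its exceptional set is enlarged to a measurable null set before
  -- it is transported.
  obtain ⟨N, hGN, hN, hN0⟩ := exists_measurable_superset_of_null (ae_iff.1 hG)
  have hN' : ∀ᵐ x ∂M.bernoulliBase, x ∉ N := by rwa [ae_iff, show {x | ¬x ∉ N} = N by simp]
  have h1 := Measure.ae_ae_of_ae_prod
    (h.measurePreserving_joinTable.quasiMeasurePreserving.ae hN')
  filter_upwards [h1] with ω hω
  have hmeas : Measurable fun u : M.Words ω => (fun n => (⟨ω n, u n⟩ : M.Symbols)) :=
    measurable_pi_lambda _ fun n =>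
      (measurable_of_finite fun v : Fin (M.k (ω n)) => (⟨ω n, v⟩ : M.Symbols)).comp
        (measurable_pi_apply n)
  have h2 : ∀ᵐ u ∂(M.wordMeasure ω), (fun n => (⟨ω n, u n⟩ : M.Symbols)) ∉ N := by
    have hset : MeasurableSet {u : M.Words ω | (fun n => (⟨ω n, u n⟩ : M.Symbols)) ∉ N} :=
      hmeas hN.compl
    rw [← (M.measurePreserving_readTable ω).map_eq,
      ae_map_iff (M.measurePreserving_readTable ω).measurable.aemeasurable hset]
    exact hω
  filter_upwards [h2] with u hu
  by_contra hcon
  exact hu (hGN hcon)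

theorem IsBernoulli.ae_symbolEta_no_atoms (h : M.IsBernoulli) (hM : M.IsNontrivial) :
    ∀ᵐ x ∂M.bernoulliBase, M.symbolEta x {M.point x} = 0 := by
  have hPp : IsProbabilityMeasure M.P := M.isProbabilityMeasure
  rw [← h.measurePreserving_joinTable.map_eq]
  have hset : MeasurableSet {x : ℕ → M.Symbols | M.symbolEta x {M.point x} = 0} := by
    let κ : ProbabilityTheory.Kernel (ℕ → M.Symbols) ℝ := ⟨M.symbolEta, M.measurable_symbolEta⟩
    have : ProbabilityTheory.IsMarkovKernel κ := ⟨fun x => inferInstanceAs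
      (IsProbabilityMeasure (M.symbolEta x))⟩
    have hm : MeasurableSet {p : (ℕ → M.Symbols) × ℝ | p.2 = M.point p.1} :=
      measurableSet_eq_fun measurable_snd (M.measurable_point.comp measurable_fst)
    exact ProbabilityTheory.Kernel.measurable_kernel_prodMk_left (κ := κ) hm
      (measurableSet_singleton 0)
  rw [ae_map_iff measurable_joinTable.aemeasurable hset]
  filter_upwards [Measure.quasiMeasurePreserving_fst.ae hM] with p hp
  exact hp _

end Model

namespace Model

/-! ### Generated distributions -/

section Generation

variable {Z : Type*} [TopologicalSpace Z] [MeasurableSpace Z] [OpensMeasurableSpace Z]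

theorem intervalIntegrable_comp_curve [CompactSpace Z] {γ : ℝ → Z} (hγ : Measurable γ)
    (f : C(Z, ℝ)) (a b : ℝ) : IntervalIntegrable (fun s => f (γ s)) volume a b :=
  (intervalIntegrable_const (c := ‖f‖)).mono_fun
    ((map_continuous f).measurable.comp hγ).aestronglyMeasurable
    (Eventually.of_forall fun s => by
      rw [norm_norm]
      exact ContinuousMap.norm_coe_le_norm f _)

/-- Convergence of the means along a curve is a closed condition on the test function. -/
theorem tendsto_mean_of_dense [CompactSpace Z] {γ : ℝ → Z} (hγ : Measurable γ) {Q : Measure Z}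
    [IsProbabilityMeasure Q] {u : ℕ → C(Z, ℝ)} (hu : DenseRange u)
    (h : ∀ n, Tendsto (fun t : ℝ => t⁻¹ * ∫ s in (0 : ℝ)..t, u n (γ s)) atTop
      (𝓝 (∫ z, u n z ∂Q))) (f : C(Z, ℝ)) :
    Tendsto (fun t : ℝ => t⁻¹ * ∫ s in (0 : ℝ)..t, f (γ s)) atTop (𝓝 (∫ z, f z ∂Q)) := by
  have hint : ∀ g : C(Z, ℝ), Integrable (fun z => g z) Q := fun g =>
    Integrable.of_bound (map_continuous g).measurable.aestronglyMeasurable ‖g‖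
      (Eventually.of_forall fun z => ContinuousMap.norm_coe_le_norm g z)
  rw [Metric.tendsto_atTop']
  intro ε hε
  obtain ⟨n, hn⟩ := hu.exists_dist_lt f (show (0 : ℝ) < ε / 3 by positivity)
  obtain ⟨N, hN⟩ := Metric.tendsto_atTop'.1 (h n) (ε / 3) (by positivity)
  refine ⟨max N 0, fun t ht => ?_⟩
  have h0 : 0 < t := (le_max_right _ _).trans_lt ht
  have h1 := hN t ((le_max_left _ _).trans_lt ht)
  have hpt : ∀ z, ‖f z - u n z‖ ≤ ε / 3 := fun z => by
    rw [← dist_eq_norm]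
    exact (ContinuousMap.dist_apply_le_dist z).trans hn.le
  have h2 : |t⁻¹ * (∫ s in (0 : ℝ)..t, f (γ s)) - t⁻¹ * ∫ s in (0 : ℝ)..t, u n (γ s)| ≤ ε / 3 := by
    rw [← mul_sub, ← intervalIntegral.integral_sub (intervalIntegrable_comp_curve hγ f _ _)
      (intervalIntegrable_comp_curve hγ (u n) _ _), abs_mul, abs_of_pos (inv_pos.2 h0)]
    have := intervalIntegral.norm_integral_le_of_norm_le_const (a := 0) (b := t)
      (f := fun s => f (γ s) - u n (γ s)) fun s _ => hpt (γ s)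
    rw [sub_zero, abs_of_pos h0, Real.norm_eq_abs] at this
    rw [inv_mul_le_iff₀ h0, mul_comm t]
    exact this
  have h3 : |(∫ z, f z ∂Q) - ∫ z, u n z ∂Q| ≤ ε / 3 := by
    rw [← integral_sub (hint f) (hint (u n))]
    have := norm_integral_le_of_norm_le_const (μ := Q) (Eventually.of_forall hpt)
    simpa using this
  rw [Real.dist_eq] at h1 ⊢
  rw [abs_lt] at h1 ⊢
  rw [abs_le] at h2 h3
  constructor <;> linarith [h1.1, h1.2, h2.1, h2.2, h3.1, h3.2]

/-- The two integrals differ by integrals over two intervals of length `|τ|`, which are bounded.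
This lets the scenery start at time `0`, although it follows the suspension only from time `τ`. -/
theorem tendsto_mean_of_delay {h : ℝ → ℝ} {C L τ : ℝ}
    (hi : ∀ a b, IntervalIntegrable h volume a b) (hC : ∀ s, ‖h s‖ ≤ C)
    (hL : Tendsto (fun t : ℝ => t⁻¹ * ∫ s in (0 : ℝ)..t, h (τ + s)) atTop (𝓝 L)) :
    Tendsto (fun t : ℝ => t⁻¹ * ∫ s in (0 : ℝ)..t, h s) atTop (𝓝 L) := by
  have herr : Tendsto (fun t : ℝ => t⁻¹ * ((∫ s in (0 : ℝ)..τ, h s) - ∫ s in t..(τ + t), h s))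
      atTop (𝓝 0) := by
    have hz : Tendsto (fun t : ℝ => t⁻¹ * (C * |τ| + C * |τ|)) atTop (𝓝 0) := by
      simpa using tendsto_inv_atTop_zero.mul_const (C * |τ| + C * |τ|)
    refine squeeze_zero_norm' ?_ hz
    filter_upwards [eventually_gt_atTop (0 : ℝ)] with t ht
    rw [norm_mul, Real.norm_of_nonneg (inv_nonneg.2 ht.le)]
    refine mul_le_mul_of_nonneg_left ((norm_sub_le _ _).trans (add_le_add ?_ ?_))
      (inv_nonneg.2 ht.le)
    · have := intervalIntegral.norm_integral_le_of_norm_le_const (a := 0) (b := τ) fun s _ => hC s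
      rwa [sub_zero] at this
    · have := intervalIntegral.norm_integral_le_of_norm_le_const (a := t) (b := τ + t)
        fun s _ => hC s
      rwa [add_sub_cancel_right] at this
  have := hL.add herr
  rw [add_zero] at this
  refine this.congr fun t => ?_
  rw [← mul_add, intervalIntegral.integral_comp_add_left h, add_zero,
    ← intervalIntegral.integral_add_adjacent_intervals (hi 0 τ) (hi τ t),
    ← intervalIntegral.integral_add_adjacent_intervals (hi τ t) (hi t (τ + t))]
  ring

end Generation

variable {I : Type*} [Fintype I] [MeasurableSpace I] (M : Model I)

/-! ### Extensions of the Bernoulli base -/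

/-- A system over the Bernoulli base that carries an orientation `σ x = ±1`, which is reversed
whenever the contraction ratio of the first symbol is negative, together with the correspondingly
oriented measures `E x`. -/
structure IsOriented {X : Type*} [MeasurableSpace X] (m : Measure X) (T : X → X)
    (π : X → ℕ → M.Symbols) (σ : X → ℝ) (E : X → ProbabilityMeasure Scenery.Window) : Prop where
  ergodic : Ergodic T m
  base : MeasurePreserving π m M.bernoulliBase
  abs_sign : ∀ x, |σ x| = 1
  measurable : Measurable E
  eq_blowUpAt : ∀ x, E x = M.blowUpAt (π x) (σ x)
  map_shift : ∀ᵐ x ∂m, π (T x) = Suspension.shift (π x)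
  sign_shift : ∀ᵐ x ∂m, M.r (π x 0).1 * σ (T x) = |M.r (π x 0).1| * σ x

variable {M}

section

variable {X : Type*} [MeasurableSpace X] {m : Measure X} {T : X → X} {π : X → ℕ → M.Symbols}
  {σ : X → ℝ} {E : X → ProbabilityMeasure Scenery.Window}

theorem IsOriented.sign_ne_zero (h : M.IsOriented m T π σ E) (x : X) : σ x ≠ 0 := fun h0 => by
  have := h.abs_sign x
  rw [h0, abs_zero] at this
  exact zero_ne_one this

theorem IsOriented.scale_eq (h : M.IsOriented m T π σ E) (x : X) {t : ℝ} (ht : 0 ≤ t) :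
    Scenery.scale t (E x) = M.blowUpAt (π x) (σ x * Real.exp (-t)) := by
  rw [h.eq_blowUpAt, M.scale_blowUpAt _ (h.sign_ne_zero x) ht]

/-- After time `τ + ρ + w` the signed factor is `σ(x) |r| e^{-(τ+w)}`, which equals `r σ(T x)
e^{-(τ+w)}` by the sign rule. Since `e^{-(τ+w)} ≤ e^{-τ}`, `blowUpAt_shift` strips off the `r`. -/
theorem IsOriented.isCover (h : M.IsOriented m T π σ E) {τ : ℝ} (hτ0 : 0 ≤ τ)
    (hτ : M.SeparatedAtScale τ) :
    Suspension.IsCover m T (fun x => M.roof (π x)) Scenery.scale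
      (fun x w => Scenery.scale (τ + w) (E x)) where
  measurable := by
    have h1 : Measurable fun z : X × ℝ => τ + z.2 := measurable_snd.const_add τ
    have h2 : Measurable fun z : X × ℝ => E z.1 := h.measurable.comp measurable_fst
    exact Scenery.measurable_scale_comp h1 h2
  measurable_flow := Scenery.measurable_scale
  jump := by
    filter_upwards [h.map_shift, h.sign_shift] with x h1 h2 w hw
    have hr : 0 < |M.r (π x 0).1| := abs_pos.2 (M.r_ne_zero _)
    have hρ : 0 ≤ M.roof (π x) := by
      rw [roof, Left.nonneg_neg_iff]
      exact Real.log_nonpos hr.le (M.abs_r_lt_one _).le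
    have he : Real.exp (-(τ + (M.roof (π x) + w))) =
        |M.r (π x 0).1| * Real.exp (-(τ + w)) := by
      rw [show -(τ + (M.roof (π x) + w)) = Real.log |M.r (π x 0).1| + -(τ + w) by
        rw [roof]; ring, Real.exp_add, Real.exp_log hr]
    rw [h.scale_eq x (by positivity), h.scale_eq (T x) (by positivity), he, h1,
      ← M.blowUpAt_shift hτ (π x)
        (mul_ne_zero (h.sign_ne_zero (T x)) (Real.exp_pos (-(τ + w))).ne') ?_]
    · congr 1
      rw [← mul_assoc, ← mul_assoc, h2, mul_comm (σ x)]
    · rw [abs_mul, h.abs_sign, one_mul, abs_of_pos (Real.exp_pos _)]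
      exact Real.exp_le_exp.2 (by linarith)
  semiflow x s t hs ht := by
    rw [h.scale_eq x (add_nonneg hτ0 hs), h.scale_eq x (add_nonneg hτ0 (add_nonneg hs ht)),
      M.scale_blowUpAt _ (mul_ne_zero (h.sign_ne_zero x) (Real.exp_pos _).ne') ht, mul_assoc,
      ← Real.exp_add]
    congr 3
    ring

theorem IsOriented.exists_isRoof (h : M.IsOriented m T π σ E) :
    ∃ c R, Suspension.IsRoof (fun x => M.roof (π x)) c R := by
  have h0 : Measurable fun x => π x 0 := (measurable_pi_apply 0).comp h.base.measurable
  have hm : Measurable fun x => M.roof (π x) :=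
    (Measurable.of_discrete (f := fun s : M.Symbols => -Real.log |M.r s.1|)).comp h0
  cases isEmpty_or_nonempty I with
  | inl hI => exact ⟨1, 1, hm, one_pos, fun x => (hI.false (π x 0).1).elim,
      fun x => (hI.false (π x 0).1).elim⟩
  | inr hI =>
    obtain ⟨i, -, hi⟩ := Finset.exists_min_image Finset.univ (fun i => -Real.log |M.r i|)
      Finset.univ_nonempty
    obtain ⟨j, -, hj⟩ := Finset.exists_max_image Finset.univ (fun i => -Real.log |M.r i|)
      Finset.univ_nonempty
    refine ⟨-Real.log |M.r i|, -Real.log |M.r j|, hm, ?_, fun x => hi _ (Finset.mem_univ _),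
      fun x => hj _ (Finset.mem_univ _)⟩
    rw [Left.neg_pos_iff]
    exact Real.log_neg (abs_pos.2 (M.r_ne_zero i)) (M.abs_r_lt_one i)

variable [IsProbabilityMeasure m]

/-- The law of `S_{τ + s} E x` does not depend on `τ`. -/
theorem IsOriented.law_eq (h : M.IsOriented m T π σ E) {τ τ' : ℝ} (hτ0 : 0 ≤ τ) (hle : τ ≤ τ')
    (hτ : M.SeparatedAtScale τ) (hτ' : M.SeparatedAtScale τ') :
    (Suspension.measure m fun x => M.roof (π x)).map
        (Function.uncurry fun x w => Scenery.scale (τ' + w) (E x)) =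
      (Suspension.measure m fun x => M.roof (π x)).map
        (Function.uncurry fun x w => Scenery.scale (τ + w) (E x)) := by
  obtain ⟨c, R, hρ⟩ := h.exists_isRoof
  have hN := h.isCover hτ0 hτ
  have hN' := h.isCover (hτ0.trans hle) hτ'
  -- The law for `τ'` is the image of the law for `τ` under `S_{τ' - τ}`, which preserves it.
  have hinv := hN.measurePreserving_flow h.ergodic.toMeasurePreserving hρ (sub_nonneg.2 hle)
  rw [← hinv.map_eq, Measure.map_map hinv.measurable hN.measurable]
  refine Measure.map_congr ((Suspension.ae_measure_iff hρ).2 (Eventually.of_forall fun z hz => ?_))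
  have := hN.semiflow z.1 z.2 (τ' - τ) hz.1 (sub_nonneg.2 hle)
  simp only [Function.comp, Function.uncurry, this]
  congr 1
  ring

theorem IsOriented.ae_law_centered (h : M.IsOriented m T π σ E) {τ : ℝ} (hτ0 : 0 ≤ τ)
    (hτ : M.SeparatedAtScale τ) :
    ∀ᵐ μ ∂((Suspension.measure m fun x => M.roof (π x)).map
      (Function.uncurry fun x w => Scenery.scale (τ + w) (E x))), μ ∈ Scenery.Centered := by
  obtain ⟨c, R, hρ⟩ := h.exists_isRoof
  have hset : MeasurableSet {μ | μ ∈ Scenery.Centered} := Scenery.measurableSet_centered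
  rw [ae_map_iff (h.isCover hτ0 hτ).measurable.aemeasurable hset, Suspension.ae_measure_iff hρ]
  refine Eventually.of_forall fun z hreg => ?_
  rw [Function.uncurry, h.scale_eq _ (add_nonneg hτ0 hreg.1)]
  exact Scenery.origin_mem_support_blowUp (M.point_mem_support _)
    (mul_ne_zero (h.sign_ne_zero _) (Real.exp_pos _).ne')

theorem IsOriented.ae_law_origin [MeasurableSingletonClass I] (h : M.IsOriented m T π σ E)
    (hb : M.IsBernoulli) (hM : M.IsNontrivial) {τ : ℝ} (hτ0 : 0 ≤ τ)
    (hτ : M.SeparatedAtScale τ) :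
    ∀ᵐ μ : ProbabilityMeasure Scenery.Window ∂((Suspension.measure m fun x => M.roof (π x)).map
      (Function.uncurry fun x w => Scenery.scale (τ + w) (E x))),
      (μ : Measure Scenery.Window) {Scenery.origin} = 0 := by
  obtain ⟨c, R, hρ⟩ := h.exists_isRoof
  rw [ae_map_iff (h.isCover hτ0 hτ).measurable.aemeasurable Scenery.measurableSet_origin_null,
    Suspension.ae_measure_iff hρ]
  have := (Measure.quasiMeasurePreserving_fst (μ := m) (ν := (volume : Measure ℝ))).ae
    (h.base.quasiMeasurePreserving.ae (hb.ae_symbolEta_no_atoms hM))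
  filter_upwards [this] with z hz hreg
  rw [Function.uncurry, h.scale_eq _ (add_nonneg hτ0 hreg.1)]
  exact Scenery.blowUp_origin_eq_zero (M.point_mem_support _)
    (mul_ne_zero (h.sign_ne_zero _) (Real.exp_pos _).ne') hz

/-- A dense sequence of test functions produces a single null set that works for all continuous
functions. -/
theorem IsOriented.ae_tendsto_mean (h : M.IsOriented m T π σ E) {τ : ℝ} (hτ0 : 0 ≤ τ)
    (hτ : M.SeparatedAtScale τ) :
    ∀ᵐ x ∂m, ∀ f : C(ProbabilityMeasure Scenery.Window, ℝ),
      Tendsto (fun t : ℝ => t⁻¹ * ∫ s in (0 : ℝ)..t, f (Scenery.scale s (E x))) atTop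
        (𝓝 (∫ ν, f ν ∂((Suspension.measure m fun x => M.roof (π x)).map
          (Function.uncurry fun x w => Scenery.scale (τ + w) (E x))))) := by
  obtain ⟨c, R, hρ⟩ := h.exists_isRoof
  have hN := h.isCover hτ0 hτ
  have hprob := Suspension.isProbabilityMeasure_measure (m := m) hρ
  have hprobQ := Measure.isProbabilityMeasure_map
    (μ := Suspension.measure m fun x => M.roof (π x)) hN.measurable.aemeasurable
  have hae : ∀ᵐ x ∂m, ∀ n, Tendsto (fun t : ℝ => t⁻¹ * ∫ s in (0 : ℝ)..t,
      TopologicalSpace.denseSeq C(ProbabilityMeasure Scenery.Window, ℝ) n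
        (Scenery.scale (τ + s) (E x))) atTop
      (𝓝 (∫ ν, TopologicalSpace.denseSeq C(ProbabilityMeasure Scenery.Window, ℝ) n ν
        ∂((Suspension.measure m fun x => M.roof (π x)).map
          (Function.uncurry fun x w => Scenery.scale (τ + w) (E x))))) := by
    rw [ae_all_iff]
    exact fun n => hN.ae_tendsto_mean h.ergodic hρ (map_continuous _).measurable
      (C := ‖TopologicalSpace.denseSeq C(ProbabilityMeasure Scenery.Window, ℝ) n‖)
      fun z => by rw [← Real.norm_eq_abs]; exact ContinuousMap.norm_coe_le_norm _ z
  filter_upwards [hae] with x hx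
  have hcurve : Measurable fun s : ℝ => Scenery.scale s (E x) :=
    Scenery.measurable_scale_comp measurable_id measurable_const
  exact tendsto_mean_of_dense hcurve (TopologicalSpace.denseRange_denseSeq _) fun n =>
    tendsto_mean_of_delay (fun a b => intervalIntegrable_comp_curve hcurve _ a b)
      (fun s => ContinuousMap.norm_coe_le_norm _ _) (hx n)

theorem ne_trivialDistribution {Q : Scenery.Distribution}
    (h : ∀ᵐ μ : ProbabilityMeasure Scenery.Window ∂(Q : Measure (ProbabilityMeasure Scenery.Window)),
      (μ : Measure Scenery.Window) {Scenery.origin} = 0) : Q ≠ Scenery.trivialDistribution := by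
  rintro rfl
  have h1 := (ae_dirac_iff (a := diracProba Scenery.origin) Scenery.measurableSet_origin_null).1 h
  have h2 : ((diracProba Scenery.origin : ProbabilityMeasure Scenery.Window) :
    Measure Scenery.Window) {Scenery.origin} = 1 := by
    have : ((diracProba Scenery.origin : ProbabilityMeasure Scenery.Window) :
      Measure Scenery.Window) = Measure.dirac Scenery.origin := rfl
    rw [this]
    simp
  rw [h2] at h1
  exact one_ne_zero h1

theorem IsOriented.exists_distribution [MeasurableSingletonClass I] (h : M.IsOriented m T π σ E)
    (hb : M.IsBernoulli) (hM : M.IsNontrivial) {τ : ℝ} (hτ0 : 0 ≤ τ)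
    (hτ : M.SeparatedAtScale τ) :
    ∃ Q : Scenery.Distribution, Q ≠ Scenery.trivialDistribution ∧ Scenery.IsErgodic Q ∧
      (∀ᵐ x ∂m, ∀ f : C(ProbabilityMeasure Scenery.Window, ℝ),
        Tendsto (fun t : ℝ => t⁻¹ * ∫ s in (0 : ℝ)..t, f (Scenery.scale s (E x))) atTop
          (𝓝 (∫ ν, f ν ∂(Q : Measure (ProbabilityMeasure Scenery.Window))))) ∧
      ∀ τ : ℝ, 0 ≤ τ → M.SeparatedAtScale τ →
        Suspension.IsFactorMap m T (fun x => M.roof (π x))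
          (fun z => Scenery.scale (τ + z.2) (E z.1)) Q := by
  obtain ⟨c, R, hρ⟩ := h.exists_isRoof
  have hN := h.isCover hτ0 hτ
  have hT := h.ergodic.toMeasurePreserving
  have hprob := Suspension.isProbabilityMeasure_measure (m := m) hρ
  refine ⟨⟨_, Measure.isProbabilityMeasure_map
      (μ := Suspension.measure m fun x => M.roof (π x)) hN.measurable.aemeasurable⟩,
    ne_trivialDistribution (h.ae_law_origin hb hM hτ0 hτ),
    ⟨h.ae_law_centered hτ0 hτ, fun t ht => hN.measurePreserving_flow hT hρ ht,
      fun A hA hinv => hN.ergodic h.ergodic hρ hA hinv⟩, h.ae_tendsto_mean hτ0 hτ, ?_⟩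
  intro τ' hτ0' hτ'
  have hN' := h.isCover hτ0' hτ'
  refine ⟨⟨hN'.measurable, ?_⟩, hN'.ae_equivariant hT hρ⟩
  rcases le_total τ τ' with hle | hle
  · exact h.law_eq hτ0 hle hτ hτ'
  · exact (h.law_eq hτ0' hle hτ' hτ).symm

end

end Model

/-! ### The Bernoulli and Markov bases as oriented systems -/

namespace Model

variable {I : Type*} [Fintype I] [MeasurableSpace I] {M : Model I}

theorem ae_bernoulliBase_zero (hs : IsProbabilityMeasure M.symbolMeasure) {p : I → Prop}
    (h : ∀ i, M.q i ≠ 0 → p i) : ∀ᵐ x ∂M.bernoulliBase, p (x 0).1 := by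
  have h1 : M.symbolMeasure {s | ¬p s.1} = 0 := by
    rw [symbolMeasure_apply]
    refine Finset.sum_eq_zero fun i _ => ?_
    by_cases hq : M.q i = 0
    · rw [hq, ENNReal.ofReal_zero, zero_mul]
    · have : {u | (⟨i, u⟩ : M.Symbols) ∈ {s : M.Symbols | ¬p s.1}} = ∅ :=
        eq_empty_of_forall_notMem fun u hu => hu (h i hq)
      rw [this, measure_empty, mul_zero]
  have h2 : ∀ᵐ s ∂M.symbolMeasure, p s.1 := h1
  exact (measurePreserving_eval_infinitePi (fun _ : ℕ => M.symbolMeasure)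
    0).quasiMeasurePreserving.ae h2

/-- If all equidistribution statements hold for almost every sequence of symbols, then `η^(ω)`
generates the distribution for almost every `ω`. -/
theorem ae_generates [MeasurableSingletonClass I] (hb : M.IsBernoulli) (hs : M.StrongSeparation)
    {Q : Scenery.Distribution}
    (h : ∀ᵐ x ∂M.bernoulliBase, ∀ f : C(ProbabilityMeasure Scenery.Window, ℝ),
      Tendsto (fun t : ℝ => t⁻¹ * ∫ s in (0 : ℝ)..t, f (Scenery.scale s (M.etaAt x))) atTop
        (𝓝 (∫ ν, f ν ∂(Q : Measure (ProbabilityMeasure Scenery.Window))))) :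
    ∀ᵐ ω ∂M.P, Scenery.Generates (M.eta ω) Q := by
  filter_upwards [hb.ae_ae_wordMeasure h] with ω hω
  show ∀ᵐ x ∂(M.wordMeasure ω).map (M.coding ω), Scenery.GeneratesAt (M.eta ω) Q x
  -- Because the coding is a measurable embedding, the set of generating points need not be shown
  -- measurable.
  rw [(hs.measurableEmbedding_coding ω).ae_map_iff]
  filter_upwards [hω] with u hu
  exact ⟨M.coding_mem_support ω u, hu⟩

/-! ### The orientation-preserving case -/

theorem isOriented_bernoulliBase [MeasurableSingletonClass I]
    (hs : IsProbabilityMeasure M.symbolMeasure) (hr : ∀ i, M.q i ≠ 0 → 0 < M.r i) :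
    M.IsOriented M.bernoulliBase Suspension.shift id (fun _ => 1) M.etaAt where
  ergodic := ergodic_shift_infinitePi M.symbolMeasure
  base := MeasurePreserving.id _
  abs_sign _ := abs_one
  measurable := M.measurable_etaAt
  eq_blowUpAt := M.etaAt_eq
  map_shift := Eventually.of_forall fun _ => rfl
  sign_shift := by
    filter_upwards [ae_bernoulliBase_zero hs hr] with x hx
    rw [id, abs_of_pos hx]

/-! ### The orientation-reversing case -/

variable (M) in
/-- The change of orientation caused by a symbol. -/
def flip (s : M.Symbols) : ZMod 2 := if M.r s.1 < 0 then 1 else 0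

variable (M) in
/-- Record the orientations along a sequence of symbols, from an initial orientation. -/
def orient (z : (ℕ → M.Symbols) × ZMod 2) (n : ℕ) : M.SignedSymbols :=
  (z.1 n, z.2 + ∑ j ∈ Finset.range n, M.flip (z.1 j))

variable (M) in
/-- The Markov measure on sequences of symbols with orientations. -/
def signedBase : Measure (ℕ → M.SignedSymbols) := (M.bernoulliBase.prod coin).map M.orient

theorem measurable_orient : Measurable M.orient := by
  have hx : ∀ n, Measurable fun z : (ℕ → M.Symbols) × ZMod 2 => z.1 n := fun n =>
    (measurable_pi_apply n).comp measurable_fst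
  have hsum : ∀ n, Measurable fun z : (ℕ → M.Symbols) × ZMod 2 =>
      z.2 + ∑ j ∈ Finset.range n, M.flip (z.1 j) := fun n => by
    induction n with
    | zero => simpa using measurable_snd
    | succ n ih =>
      have h1 : Measurable fun z : (ℕ → M.Symbols) × ZMod 2 =>
        (z.2 + ∑ j ∈ Finset.range n, M.flip (z.1 j), z.1 n) := ih.prodMk (hx n)
      have h2 : Measurable fun p : ZMod 2 × M.Symbols => p.1 + M.flip p.2 := Measurable.of_discrete
      simpa only [Function.comp_def, Finset.sum_range_succ, add_assoc] using h2.comp h1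
  exact measurable_pi_lambda _ fun n => (hx n).prodMk (hsum n)

theorem orient_skewShift (z : (ℕ → M.Symbols) × ZMod 2) :
    M.orient (skewShift M.flip z) = Suspension.shift (M.orient z) := by
  funext n
  simp only [orient, skewShift, Suspension.shift, Finset.sum_range_succ']
  congr 1
  ring

theorem measurePreserving_orient :
    MeasurePreserving M.orient (M.bernoulliBase.prod coin) M.signedBase :=
  ⟨measurable_orient, rfl⟩

/-- `orient` exhibits the chain as a factor of the skew product, which is ergodic because a symbol
with negative ratio occurs with positive probability. -/
theorem ergodic_signedBase (hs : IsProbabilityMeasure M.symbolMeasure)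
    (hr : ∃ i, M.q i ≠ 0 ∧ M.r i < 0) : Ergodic Suspension.shift M.signedBase := by
  have hne : M.symbolMeasure (M.flip ⁻¹' {0}) ≠ 1 := by
    obtain ⟨i, hq, hi⟩ := hr
    rw [Ne, ← prob_compl_eq_zero_iff MeasurableSet.of_discrete, symbolMeasure_apply,
      Finset.sum_eq_zero_iff]
    intro h
    have h1 := h i (Finset.mem_univ i)
    have : {u | (⟨i, u⟩ : M.Symbols) ∈ (M.flip ⁻¹' {0})ᶜ} = univ := by
      ext u
      simp [flip, hi]
    rw [this, measure_univ, mul_one, ENNReal.ofReal_eq_zero] at h1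
    exact hq (le_antisymm h1 (M.q_nonneg i))
  exact (measurePreserving_orient).ergodic_of_ergodic_semiconj
    (ergodic_skewShift M.symbolMeasure Measurable.of_discrete hne) Suspension.measurable_shift
    orient_skewShift

variable (M) in
/-- The sign of the initial orientation. -/
def initialSign (y : ℕ → M.SignedSymbols) : ℝ := if (y 0).2 = 0 then 1 else -1

theorem isOriented_signedBase [MeasurableSingletonClass I]
    (hs : IsProbabilityMeasure M.symbolMeasure) (hr : ∃ i, M.q i ≠ 0 ∧ M.r i < 0) :
    M.IsOriented M.signedBase Suspension.shift (fun y n => (y n).1) M.initialSign M.signedEtaAt where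
  ergodic := ergodic_signedBase hs hr
  base := by
    have hm : Measurable fun (y : ℕ → M.SignedSymbols) n => (y n).1 :=
      measurable_pi_lambda _ fun n => measurable_fst.comp (measurable_pi_apply n)
    refine ⟨hm, ?_⟩
    rw [signedBase, Measure.map_map hm measurable_orient]
    exact (measurePreserving_fst (μ := M.bernoulliBase) (ν := coin)).map_eq
  abs_sign y := by
    by_cases h : (y 0).2 = 0 <;> simp [initialSign, h]
  measurable := by
    have hm : Measurable fun (y : ℕ → M.SignedSymbols) n => (y n).1 :=
      measurable_pi_lambda _ fun n => measurable_fst.comp (measurable_pi_apply n)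
    have hset : MeasurableSet {y : ℕ → M.SignedSymbols | (y 0).2 = 0} :=
      (measurable_snd.comp (measurable_pi_apply 0)) (measurableSet_singleton 0)
    exact Measurable.ite hset (M.measurable_etaAt.comp hm)
      ((Scenery.measurable_reflect.comp M.measurable_etaAt).comp hm)
  eq_blowUpAt y := by
    by_cases h : (y 0).2 = 0
    · rw [signedEtaAt, initialSign, if_pos h, if_pos h, etaAt_eq]
    · rw [signedEtaAt, initialSign, if_neg h, if_neg h, reflect_etaAt_eq]
  map_shift := Eventually.of_forall fun _ => rfl
  sign_shift := by
    have hm : Measurable fun y : ℕ → M.SignedSymbols => (y 0, y 1) :=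
      (measurable_pi_apply 0).prodMk (measurable_pi_apply 1)
    have hset : MeasurableSet {y : ℕ → M.SignedSymbols | M.r (y 0).1.1 *
        M.initialSign (Suspension.shift y) = |M.r (y 0).1.1| * M.initialSign y} :=
      hm (MeasurableSet.of_discrete (s := {p : M.SignedSymbols × M.SignedSymbols |
        M.r p.1.1.1 * (if p.2.2 = 0 then 1 else -1) =
          |M.r p.1.1.1| * (if p.1.2 = 0 then 1 else -1)}))
    -- The sign rule can fail for arbitrary signed sequences; it holds on the image of `orient`,
    -- where consecutive orientations differ by `flip`.
    rw [signedBase, ae_map_iff measurable_orient.aemeasurable hset]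
    refine Eventually.of_forall fun z => ?_
    have h01 : ∀ a : ZMod 2, a = 0 ∨ a = 1 := by decide
    have h11 : (1 : ZMod 2) + 1 = 0 := by decide
    have hne := M.r_ne_zero (z.1 0).1
    have e0 : (M.orient z 0).2 = z.2 := by simp [orient]
    have e1 : (M.orient z 1).2 = z.2 + M.flip (z.1 0) := by
      simp only [orient, Finset.sum_range_one]
    show M.r (z.1 0).1 * (if (M.orient z 1).2 = 0 then (1 : ℝ) else -1) =
      |M.r (z.1 0).1| * (if (M.orient z 0).2 = 0 then (1 : ℝ) else -1)
    rw [e0, e1]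
    by_cases h : M.r (z.1 0).1 < 0
    · rw [flip, if_pos h, abs_of_neg h]
      rcases h01 z.2 with ha | ha <;> simp [ha, h11]
    · have h' : 0 < M.r (z.1 0).1 := lt_of_le_of_ne (not_lt.1 h) hne.symm
      rw [flip, if_neg h, abs_of_pos h', add_zero]

/-- Both initial orientations have positive mass, so an almost sure statement restricts to
orientation `0`, where `signedEtaAt` is `etaAt`. -/
theorem ae_bernoulliBase_of_signedBase (hs : IsProbabilityMeasure M.symbolMeasure)
    {G : ProbabilityMeasure Scenery.Window → Prop} (h : ∀ᵐ y ∂M.signedBase, G (M.signedEtaAt y)) :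
    ∀ᵐ x ∂M.bernoulliBase, G (M.etaAt x) := by
  have hb : IsProbabilityMeasure M.bernoulliBase := by
    rw [bernoulliBase_eq]; infer_instance
  have h1 := ae_prod_coin_iff.1 ((measurePreserving_orient).quasiMeasurePreserving.ae h)
  filter_upwards [h1] with x hx
  have h2 := hx 0
  rw [signedEtaAt, if_pos (by simp [orient])] at h2
  exact h2

theorem signedTransition_eq (s s' : M.SignedSymbols) :
    M.signedTransition s s' = if s'.2 = s.2 + M.flip s.1 then M.symbolWeight s'.1 else 0 := by
  have h01 : ∀ a b : ZMod 2, b = a + 1 ↔ b ≠ a := by decide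
  rw [signedTransition]
  refine if_congr ?_ rfl rfl
  have hne := M.r_ne_zero s.1.1
  by_cases h : M.r s.1.1 < 0
  · simp [flip, h, h01, not_lt.2 h.le]
  · have h' : 0 < M.r s.1.1 := lt_of_le_of_ne (not_lt.1 h) hne.symm
    simp [flip, h, h']

theorem sum_signedTransition (hsum : ∑ s, M.symbolWeight s = 1) (s : M.SignedSymbols) :
    ∑ s', M.signedTransition s s' = 1 := by
  simp_rw [signedTransition_eq]
  rw [Fintype.sum_prod_type]
  simp [hsum]

theorem signedTransition_nonneg (s s' : M.SignedSymbols) : 0 ≤ M.signedTransition s s' := by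
  rw [signedTransition_eq]
  split_ifs
  · exact M.symbolWeight_nonneg _
  · exact le_rfl

/-- For each preceding symbol exactly one of its two orientations is compatible with `s'`, so the
factor `1/2` survives the summation. -/
theorem signedWeight_stationary (hsum : ∑ s, M.symbolWeight s = 1) (s' : M.SignedSymbols) :
    ∑ s, M.signedWeight s * M.signedTransition s s' = M.signedWeight s' := by
  simp_rw [signedTransition_eq, signedWeight]
  rw [Fintype.sum_prod_type]
  have : ∀ s : M.Symbols, ∑ a : ZMod 2, M.symbolWeight s / 2 *
      (if s'.2 = a + M.flip s then M.symbolWeight s'.1 else 0) =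
      M.symbolWeight s * (M.symbolWeight s'.1 / 2) := fun s => by
    have : ∀ a : ZMod 2, s'.2 = a + M.flip s ↔ s'.2 - M.flip s = a := fun a =>
      sub_eq_iff_eq_add.symm
    simp only [this, mul_ite, mul_zero, Finset.sum_ite_eq, Finset.mem_univ, if_true]
    ring
  simp_rw [this]
  rw [← Finset.sum_mul, hsum, one_mul]

/-- The next symbol is free among those of positive weight but its orientation is forced. If that is
the wrong one, a detour through a symbol of negative ratio corrects it, so two steps suffice. -/
theorem signedTransition_irreducible (hr : ∃ i, M.q i ≠ 0 ∧ M.r i < 0) (s s' : M.SignedSymbols)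
    (h : 0 < M.signedWeight s') :
    Relation.TransGen (fun a b => 0 < M.signedTransition a b) s s' := by
  have hw : 0 < M.symbolWeight s'.1 := by
    rw [signedWeight] at h
    linarith
  have h01 : ∀ a b : ZMod 2, a = b ∨ a = b + 1 := by decide
  rcases h01 s'.2 (s.2 + M.flip s.1) with h0 | h1
  · refine Relation.TransGen.single ?_
    rw [signedTransition_eq, if_pos h0]
    exact hw
  · obtain ⟨i, hq, hi⟩ := hr
    have hq' : 0 < M.q i := lt_of_le_of_ne (M.q_nonneg i) hq.symm
    obtain ⟨j⟩ : Nonempty (Fin (M.k i)) := by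
      by_contra hE
      rw [not_nonempty_iff] at hE
      have := M.p_sum i
      simp at this
    refine Relation.TransGen.tail (b := ((⟨i, j⟩ : M.Symbols), s.2 + M.flip s.1))
      (Relation.TransGen.single ?_) ?_
    · rw [signedTransition_eq, if_pos rfl]
      exact mul_pos hq' (M.p_pos i j)
    · rw [signedTransition_eq, if_pos (by rw [h1]; simp [flip, hi])]
      exact hw

/-- The initial orientation and the symbols determine all later orientations. The preimage of a
cylinder is thus a box of symbols times one coin outcome if the prescribed orientations are
consistent, and empty otherwise; in the latter case some transition probability is zero. -/
theorem signedBase_cylinder (hs : IsProbabilityMeasure M.symbolMeasure) (n : ℕ)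
    (a : ℕ → M.SignedSymbols) : M.signedBase.real {y | ∀ j ≤ n, y j = a j} =
      M.signedWeight (a 0) * ∏ j ∈ Finset.range n, M.signedTransition (a j) (a (j + 1)) := by
  have hset : MeasurableSet {y : ℕ → M.SignedSymbols | ∀ j ≤ n, y j = a j} := by
    have : {y : ℕ → M.SignedSymbols | ∀ j ≤ n, y j = a j} =
        ⋂ j ∈ Finset.range (n + 1), (fun y => y j) ⁻¹' {a j} := by
      ext y
      simp
    rw [this]
    exact Finset.measurableSet_biInter _ fun j _ =>
      measurable_pi_apply j MeasurableSet.of_discrete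
  have hb : IsProbabilityMeasure M.bernoulliBase := by
    rw [bernoulliBase_eq]; infer_instance
  rw [Measure.real, signedBase, Measure.map_apply measurable_orient hset]
  by_cases hc : ∀ j < n, (a (j + 1)).2 = (a j).2 + M.flip (a j).1
  · have hpre : M.orient ⁻¹' {y | ∀ j ≤ n, y j = a j} =
        ((Finset.range (n + 1) : Set ℕ).pi fun j => {(a j).1}) ×ˢ {(a 0).2} := by
      ext z
      simp only [mem_preimage, mem_ofPred_eq, mem_prod, Set.mem_pi, Finset.coe_range, mem_Iio,
        mem_singleton_iff, Nat.lt_succ_iff]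
      constructor
      · intro h
        refine ⟨fun j hj => congrArg Prod.fst (h j hj), ?_⟩
        have := congrArg Prod.snd (h 0 (Nat.zero_le n))
        simpa [orient] using this
      · rintro ⟨h1, h2⟩ j hj
        refine Prod.ext (h1 j hj) ?_
        induction j with
        | zero => simpa [orient] using h2
        | succ j ih =>
          have := ih (by omega)
          simp only [orient] at this ⊢
          rw [Finset.sum_range_succ, ← add_assoc, this, h1 j (by omega), hc j (by omega)]
    have hprod : ∏ j ∈ Finset.range n, M.signedTransition (a j) (a (j + 1)) =
        ∏ j ∈ Finset.range n, M.symbolWeight (a (j + 1)).1 :=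
      Finset.prod_congr rfl fun j hj => by
        rw [signedTransition_eq, if_pos (hc j (Finset.mem_range.1 hj))]
    rw [hpre, Measure.prod_prod, coin_singleton, bernoulliBase_eq,
      Measure.infinitePi_pi _ fun i _ => MeasurableSet.of_discrete, hprod, signedWeight]
    simp_rw [symbolMeasure_singleton]
    rw [ENNReal.toReal_mul, ENNReal.toReal_prod, Finset.prod_range_succ']
    simp only [ENNReal.toReal_ofReal (M.symbolWeight_nonneg _), ENNReal.toReal_inv,
      ENNReal.toReal_ofNat]
    ring
  · push Not at hc
    obtain ⟨j, hj, hne⟩ := hc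
    have hpre : M.orient ⁻¹' {y | ∀ j ≤ n, y j = a j} = ∅ := by
      refine eq_empty_of_forall_notMem fun z hz => hne ?_
      have h1 := hz j (by omega)
      rw [← hz (j + 1) (by omega), ← h1]
      simp only [orient, Finset.sum_range_succ, add_assoc]
    rw [hpre, measure_empty, Finset.prod_eq_zero (Finset.mem_range.2 hj)]
    · simp
    · rw [signedTransition_eq, if_neg hne]

theorem isIrreducibleMarkov_signedBase [MeasurableSingletonClass I] (hb : M.IsBernoulli)
    (hr : ∃ i, M.q i ≠ 0 ∧ M.r i < 0) :
    Suspension.IsIrreducibleMarkov M.signedWeight M.signedTransition M.signedBase where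
  nonneg s := div_nonneg (M.symbolWeight_nonneg s.1) zero_le_two
  sum_eq_one := by
    simp_rw [signedWeight]
    rw [Fintype.sum_prod_type]
    simp only [Finset.sum_const, Finset.card_univ, ZMod.card, nsmul_eq_mul, Nat.cast_ofNat]
    rw [← hb.sum_symbolWeight]
    exact Finset.sum_congr rfl fun s _ => by ring
  transition_nonneg := signedTransition_nonneg
  transition_sum := sum_signedTransition hb.sum_symbolWeight
  stationary := signedWeight_stationary hb.sum_symbolWeight
  irreducible := signedTransition_irreducible hr
  isProbabilityMeasure := by
    have := hb.isProbabilityMeasure_symbolMeasure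
    have hbp : IsProbabilityMeasure M.bernoulliBase := by
      rw [bernoulliBase_eq]; infer_instance
    exact Measure.isProbabilityMeasure_map measurable_orient.aemeasurable
  cylinder := signedBase_cylinder hb.isProbabilityMeasure_symbolMeasure

end Model

end

/-! ### Assembly of the two orientation cases -/

theorem theorem1p3 {I : Type*} [Fintype I] [MeasurableSpace I] [MeasurableSingletonClass I]
    (M : Model I) (hnontrivial : M.IsNontrivial) (hbernoulli : M.IsBernoulli)
    (hssc : M.StrongSeparation) :
    ∃ Q : Scenery.Distribution,
      Q ≠ Scenery.trivialDistribution ∧ Scenery.IsErgodic Q ∧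
      (∀ᵐ ω ∂M.P, Scenery.Generates (M.eta ω) Q) ∧
      (∃ τ : ℝ, 0 ≤ τ ∧ M.SeparatedAtScale τ) ∧
      (∀ τ : ℝ, 0 ≤ τ → M.SeparatedAtScale τ →
        ((∀ i, M.q i ≠ 0 → 0 < M.r i) →
          Suspension.IsFactorMap M.bernoulliBase Suspension.shift M.roof (M.sceneryMap τ) Q) ∧
        ((∃ i, M.q i ≠ 0 ∧ M.r i < 0) →
          ∃ m : MeasureTheory.Measure (ℕ → M.SignedSymbols),
            Suspension.IsIrreducibleMarkov M.signedWeight M.signedTransition m ∧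
            Suspension.IsFactorMap m Suspension.shift M.signedRoof (M.signedSceneryMap τ) Q)) := by
  have hs := hbernoulli.isProbabilityMeasure_symbolMeasure
  obtain ⟨τ₀, hτ₀, hsep⟩ := hssc.exists_separatedAtScale
  by_cases hr : ∃ i, M.q i ≠ 0 ∧ M.r i < 0
  · have hMarkov := Model.isIrreducibleMarkov_signedBase hbernoulli hr
    have := hMarkov.isProbabilityMeasure
    obtain ⟨Q, hQ, herg, hgen, hfac⟩ := (Model.isOriented_signedBase hs hr).exists_distribution
      hbernoulli hnontrivial hτ₀ hsep
    refine ⟨Q, hQ, herg, Model.ae_generates hbernoulli hssc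
      (Model.ae_bernoulliBase_of_signedBase hs
        (G := fun μ => ∀ f : C(ProbabilityMeasure Scenery.Window, ℝ),
        Tendsto (fun t : ℝ => t⁻¹ * ∫ s in (0 : ℝ)..t, f (Scenery.scale s μ)) atTop
          (𝓝 (∫ ν, f ν ∂(Q : Measure (ProbabilityMeasure Scenery.Window))))) hgen),
      ⟨τ₀, hτ₀, hsep⟩, fun τ h0 hτ => ⟨fun hpos => ?_, fun _ => ⟨M.signedBase, hMarkov, hfac τ h0 hτ⟩⟩⟩
    obtain ⟨i, hq, hi⟩ := hr
    exact absurd (hpos i hq) (not_lt.2 hi.le)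
  · have hpos : ∀ i, M.q i ≠ 0 → 0 < M.r i := fun i hq => by
      by_contra h
      exact hr ⟨i, hq, lt_of_le_of_ne (not_lt.1 h) (M.r_ne_zero i)⟩
    have hbp : IsProbabilityMeasure M.bernoulliBase := by
      rw [Model.bernoulliBase_eq]; infer_instance
    obtain ⟨Q, hQ, herg, hgen, hfac⟩ := (Model.isOriented_bernoulliBase hs hpos).exists_distribution
      hbernoulli hnontrivial hτ₀ hsep
    exact ⟨Q, hQ, herg, Model.ae_generates hbernoulli hssc hgen, ⟨τ₀, hτ₀, hsep⟩, fun τ h0 hτ =>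
      ⟨fun _ => hfac τ h0 hτ, fun h => absurd h hr⟩⟩
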